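/- Let $n\ge 3$, let $\mathcal M\subset\mathbb R^n$ be a smooth embedded hypersurface (without boundary), and write $\Sigma_t=\{x\in\mathcal M: x_n=t\}$. Suppose that $\mathcal M$ is a tube in the $e_n$-direction with projection interval $t(\mathcal M)$, i.e. $t(\mathcal M)\subset\mathbb R$ is a nonempty open interval, $\Sigma_t$ is nonempty and compact for all $t\in t(\mathcal M)$, and $\{x\in\mathcal M: t_1\le x_n\le t_2\}$ is compact for all $t_1,t_2\in t(\mathcal M)$. If $t\in t(\mathcal M)$ is a regular value of $x_n|_{\mathcal M}$, let $\nu=e_n^\top/|e_n^\top|$ on $\Sigma_t$ be the unit exterior normal of $\Sigma_t$ as a boundary of $\mathcal M\cap\{x_n<t\}$, where $e_n^\top$ is the orthogonal projection of $e_n$ to the tangent space of $\mathcal M$. A *cycle* is a union $\Sigma$ of finitely many connected components of such a $\Sigma_t$, oriented by $\nu$. Its *flow vector* $J(\Sigma)\in\mathbb R^n$ is the vector with $$\langle e,J(\Sigma)\rangle=F_\Sigma(e):=\int_\Sigma\langle e,\nu\rangle\qquad\text{for all } e\in\mathbb R^n,$$ the integral being taken with respect to $(n-2)$-dimensional area.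 Two cycles $\Sigma',\Sigma''$ are *equivalent* in $\mathcal M$, $\Sigma'\sim\Sigma''$, if there is an open subset $D$ of $\mathcal M$ with compact closure in $\mathcal M$ and with oriented boundary $\partial D=(-\Sigma')\cup\Sigma''$; that is, the boundary of $D$ in $\mathcal M$ is contained in $\Sigma'\cup\Sigma''$, the exterior normal of $D$ is $\nu$ along $\Sigma''\setminus\Sigma'$ and $-\nu$ along $\Sigma'\setminus\Sigma''$, and near each point of $\Sigma'\cap\Sigma''$ (where the two orientations cancel) $D$ contains, apart from the level set itself, either both sides or neither side. Then the integrals $F_\Sigma(e)$ converge, so that $J(\Sigma)$ is well defined for every cycle $\Sigma$, and: 1. if $\Sigma=\bigcup_{i=1}^m\Sigma^i$ where $\Sigma^1,\dots,\Sigma^m$ are distinct connected components of $\Sigma_t$, with $t\in t(\mathcal M)$ a regular value of $x_n|_{\mathcal M}$, then $J(\Sigma)=J(\Sigma^1)+\dots+J(\Sigma^m)$; 2. if $\mathcal M$ is minimal (has zero mean curvature) and $\Sigma',\Sigma''$ are cycles with $\Sigma'\sim\Sigma''$, then $J(\Sigma')=J(\Sigma'')$; 3. if $\mathcal M$ is minimal,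 then for every regular value $t\in t(\mathcal M)$ of $x_n|_{\mathcal M}$ the whole section $\Sigma_t$ is a cycle, and $J(\Sigma_{t_1})=J(\Sigma_{t_2})$ for all regular values $t_1,t_2\in t(\mathcal M)$; hence $J(\mathcal M):=J(\Sigma_t)$ does not depend on $t$. -/

import Mathlib

open Set Filter Topology MeasureTheory
open scoped ContDiff Gradient InnerProductSpace

namespace MinimalTube

/-- The ambient Euclidean space `ℝⁿ`, written with `n = k + 2`, so that hypersurfaces have
dimension `n - 1 = k + 1` and their regular cross-sections have dimension `n - 2 = k`. -/
abbrev Space (k : ℕ) : Type := EuclideanSpace ℝ (Fin (k + 2))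

/-- The unit vector `e_n` of the axis, i.e. the last standard basis vector. -/
noncomputable def axis (k : ℕ) : Space k := EuclideanSpace.single (Fin.last (k + 1)) (1 : ℝ)

/-- The last coordinate `x_n`. -/
def height {k : ℕ} (p : Space k) : ℝ := p (Fin.last (k + 1))

/-- `g` is a smooth local defining function of `M` in the open set `U`. -/
structure IsLocalDefiningFunction {k : ℕ} (M U : Set (Space k)) (g : Space k → ℝ) : Prop where
  isOpen : IsOpen U
  contDiffOn : ContDiffOn ℝ ∞ g U
  gradient_ne_zero : ∀ y ∈ U, ∇ g y ≠ 0
  inter_eq : M ∩ U = {y ∈ U | g y = 0}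

/-- `M` is a smooth embedded hypersurface (without boundary) of `ℝⁿ`. -/
def IsEmbeddedHypersurface {k : ℕ} (M : Set (Space k)) : Prop :=
  ∀ p ∈ M, ∃ (U : Set (Space k)) (g : Space k → ℝ), p ∈ U ∧ IsLocalDefiningFunction M U g

/-- The unit normal field `∇g / ‖∇g‖` of the level sets of `g`. -/
noncomputable def unitNormal {k : ℕ} (g : Space k → ℝ) (y : Space k) : Space k :=
  ‖∇ g y‖⁻¹ • ∇ g y

/-- The mean curvature (sum of the principal curvatures, up to sign) at `p` of the level set of `g`
through `p`: the divergence of the unit normal field `N`. The derivative of `N` takes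
values in `N^⊥` because `‖N‖ = 1`, so that the trace over `ℝⁿ` is the trace over the tangent
space, i.e. the trace of the shape operator. -/
noncomputable def meanCurvature {k : ℕ} (g : Space k → ℝ) (p : Space k) : ℝ :=
  LinearMap.trace ℝ (Space k) (fderiv ℝ (unitNormal g) p).toLinearMap

/-- The mean curvature of the hypersurface `M` vanishes at all of its points. -/
def IsMinimal {k : ℕ} (M : Set (Space k)) : Prop :=
  ∀ (U : Set (Space k)) (g : Space k → ℝ), IsLocalDefiningFunction M U g →
    ∀ p ∈ M ∩ U, meanCurvature g p = 0

/-- The tangent space `T_p M`, as a linear subspace of `ℝⁿ`. -/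
noncomputable def tangentSpace {k : ℕ} (M : Set (Space k)) (p : Space k) :
    Submodule ℝ (Space k) :=
  Submodule.span ℝ (tangentConeAt ℝ M p)

/-- The cross-section `Σ_t = M ∩ {x_n = t}`. -/
def crossSection {k : ℕ} (M : Set (Space k)) (t : ℝ) : Set (Space k) := {p ∈ M | height p = t}

/-- `M` is a tube in the `e_n`-direction with the projection interval `T`. -/
structure IsTube {k : ℕ} (M : Set (Space k)) (T : Set ℝ) : Prop where
  isOpen : IsOpen T
  ordConnected : T.OrdConnected
  nonempty : T.Nonempty
  crossSection_nonempty : ∀ t ∈ T, (crossSection M t).Nonempty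
  isCompact_crossSection : ∀ t ∈ T, IsCompact (crossSection M t)
  isCompact_portion : ∀ t₁ ∈ T, ∀ t₂ ∈ T, IsCompact {p ∈ M | t₁ ≤ height p ∧ height p ≤ t₂}

/-- `t` is a regular value of the restriction of `x_n` to `M`: at every point of `Σ_t` the
differential `v ↦ v_n` of this restriction does not vanish on the tangent space of `M`. -/
def IsRegularValue {k : ℕ} (M : Set (Space k)) (t : ℝ) : Prop :=
  ∀ p ∈ crossSection M t, ∃ v ∈ tangentSpace M p, height v ≠ 0

/-- The unit exterior normal `ν = e_n^⊤ / |e_n^⊤|` at a point `p` of a regular cross-section `Σ_t`,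
regarded as a boundary of `M ∩ {x_n < t}`. Here `e_n^⊤`, the orthogonal projection of `e_n` to
`T_p M`, is the gradient of `x_n` on `M`; so `ν` is the unit vector of `T_p M` that is orthogonal
to `T_p Σ_t` and has `⟨ν, e_n⟩ > 0`. -/
noncomputable def conormal {k : ℕ} (M : Set (Space k)) (p : Space k) : Space k :=
  ‖(tangentSpace M p).starProjection (axis k)‖⁻¹ • (tangentSpace M p).starProjection (axis k)

/-- `C` is a connected component of the cross-section `Σ_t`. -/
def IsComponent {k : ℕ} (M : Set (Space k)) (t : ℝ) (C : Set (Space k)) : Prop :=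
  ∃ p ∈ crossSection M t, C = connectedComponentIn (crossSection M t) p

/-- `S` is a cycle of the tube: a union of finitely many components of `Σ_t` for some regular value
`t` in the projection interval. Its orientation is the one given by `conormal`. -/
def IsCycle {k : ℕ} (M : Set (Space k)) (T : Set ℝ) (S : Set (Space k)) : Prop :=
  ∃ t ∈ T, IsRegularValue M t ∧ ∃ (m : ℕ) (C : Fin m → Set (Space k)),
    (∀ i, IsComponent M t (C i)) ∧ S = ⋃ i, C i

/-- The functional `F_S(e) = ∫_S ⟨e, ν⟩`, with respect to the `(n-2)`-dimensional area, i.e. the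
Hausdorff measure in its Euclidean normalization. -/
noncomputable def flowFunctional {k : ℕ} (M S : Set (Space k)) (e : Space k) : ℝ :=
  ∫ p in S, ⟪e, conormal M p⟫_ℝ ∂(Measure.euclideanHausdorffMeasure k)

/-- The flow vector `J(S)`: its coordinates are `F_S(e_1), …, F_S(e_n)`. -/
noncomputable def flowVector {k : ℕ} (M S : Set (Space k)) : Space k :=
  WithLp.toLp 2 fun i => flowFunctional M S (EuclideanSpace.single i (1 : ℝ))

/-- Oriented bordism in `M` of the cycles `S'` and `S''`: there is a relatively open and relatively
compact `D ⊆ M` with oriented boundary `∂D = (-S') ∪ S''`. The boundary of `D` in `M` lies in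
`S' ∪ S''`; along `S''` the exterior normal of `D` is `ν` (`D` lies locally just below the level of
the point), along `S'` it is `-ν` (`D` lies locally just above). Along a common part of `S'` and
`S''`, which occurs in `(-S') ∪ S''` with both orientations, `D` lies on both sides or on neither
side. -/
def OrientedBordant {k : ℕ} (M S' S'' : Set (Space k)) : Prop :=
  ∃ D : Set (Space k),
    (∃ O : Set (Space k), IsOpen O ∧ D = M ∩ O) ∧
    IsCompact (M ∩ closure D) ∧
    (M ∩ closure D) \ D ⊆ S' ∪ S'' ∧
    (∀ p ∈ S' \ S'', ∀ᶠ q in 𝓝[M] p, q ∈ D ↔ height p < height q) ∧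
    (∀ p ∈ S'' \ S', ∀ᶠ q in 𝓝[M] p, q ∈ D ↔ height q < height p) ∧
    (∀ p ∈ S' ∩ S'',
      (∀ᶠ q in 𝓝[{q ∈ M | height q ≠ height p}] p, q ∈ D) ∨
      (∀ᶠ q in 𝓝[{q ∈ M | height q ≠ height p}] p, q ∉ D))

end MinimalTube

open MinimalTube

/-! The theorem is the divergence theorem on `M` applied to the tangential part `e^⊤` of a constant
vector `e`. On a minimal hypersurface `e^⊤` is divergence free, so its flux out of a compact domain
`D ⊆ M` vanishes. If `∂D = (-Σ') ∪ Σ''`, that flux is `F_Σ''(e) - F_Σ'(e)`.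

Everything is carried out in graph charts. Near a point of a regular section, `M` is the graph of a
smooth `u` over `ℝ^k × ℝ`, the last base coordinate being the height. With `W = √(1 + |∇u|²)`, the
field `W e^⊤` is the image under the graph map of `flux u a`
(`IsGraphChart.areaElement_smul_starProjection`), where `a` is `e` in frame coordinates. Minimality
says `div (∇u / W) = 0`, which together with the symmetry of the Hessian gives `div (flux u a) = 0`
(`divergence_flux_eq_zero`). The height component of the flux is `⟨e, ν⟩` times the area element of
the slice (`IsGraphChart.sliceAreaElement_mul_inner_conormal`). The area formula therefore turns
Hausdorff integrals over `D` and over a section into integrals over the base and over one of its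
levels, and the flat divergence theorem on a half-space relates the two.

To globalize, each local identity is stated for a test function `φ` supported in a chart: `∫_D
dφ(e^⊤) = ∫_Σ'' φ⟨e, ν⟩ - ∫_Σ' φ⟨e, ν⟩` (`exists_nhds_flux_eq`). Summed over a partition of unity
the left side vanishes, because the differentials add up to zero (`flowFunctional_eq_of_bordant`).

Two regular sections bound the slab between them, so the bordism result contains the independence of
`t`. Convergence follows from the same charts, and additivity from the disjointness of components.
-/

namespace MinimalTube

/-! ### The area formula for Euclidean Hausdorff measure. -/

section AreaFormula

open scoped NNReal ENNReal

/-- The assignment `b x ↦ a x` is well defined on `b '' s`, since equal `b`-values force equal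
`a`-values, and it is `K`-Lipschitz there. The lemma serves to compare an immersion with its
derivative, each in both roles. -/
theorem euclideanHausdorffMeasure_image_le_of_dist_le {X Y Z : Type*}
    [EMetricSpace Y] [MeasurableSpace Y] [BorelSpace Y] [EMetricSpace Z] [MeasurableSpace Z]
    [BorelSpace Z] {a : X → Y} {b : X → Z} {s : Set X} {K : ℝ≥0}
    (h : ∀ x ∈ s, ∀ y ∈ s, edist (a x) (a y) ≤ K * edist (b x) (b y)) (d : ℕ) :
    μHE[d] (a '' s) ≤ (K : ℝ≥0∞) ^ d * μHE[d] (b '' s) := by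
  rcases s.eq_empty_or_nonempty with rfl | ⟨x₀, -⟩
  · simp
  have : Nonempty X := ⟨x₀⟩
  set g : Z → Y := fun z => a (Function.invFunOn b s z)
  have hinv : ∀ x ∈ s, Function.invFunOn b s (b x) ∈ s ∧ b (Function.invFunOn b s (b x)) = b x :=
    fun x hx => ⟨Function.invFunOn_mem ⟨x, hx, rfl⟩, Function.invFunOn_eq ⟨x, hx, rfl⟩⟩
  have hg : ∀ x ∈ s, g (b x) = a x := by
    intro x hx
    have := h _ (hinv x hx).1 x hx
    rw [(hinv x hx).2, edist_self, mul_zero] at this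
    exact edist_le_zero.1 this
  have hL : LipschitzOnWith K g (b '' s) := by
    rintro _ ⟨x, hx, rfl⟩ _ ⟨y, hy, rfl⟩
    rw [hg x hx, hg y hy]
    exact h x hx y hy
  have himg : g '' (b '' s) = a '' s := by
    rw [image_image]
    exact image_congr hg
  have := hL.hausdorffMeasure_image_le (d := (d : ℝ)) (by positivity)
  rw [himg, ENNReal.rpow_natCast] at this
  simp only [Measure.euclideanHausdorffMeasure_def, Measure.smul_apply, ENNReal.smul_def,
    smul_eq_mul]
  rw [mul_left_comm]
  gcongr

/-- Second countability gives a countable subcover; making it disjoint lets the local inequalities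
be summed. -/
theorem measure_le_of_locally_le {X : Type*} [TopologicalSpace X] [SecondCountableTopology X]
    [MeasurableSpace X] [OpensMeasurableSpace X] {μ ν : Measure X}
    (h : ∀ x, ∃ U ∈ 𝓝 x, ∀ s ⊆ U, MeasurableSet s → μ s ≤ ν s) : μ ≤ ν := by
  choose U hU hle using h
  have hU' : ∀ x, interior (U x) ∈ 𝓝 x := fun x => interior_mem_nhds.2 (hU x)
  obtain ⟨c, hc, hcov⟩ := TopologicalSpace.countable_cover_nhds hU'
  rcases c.eq_empty_or_nonempty with rfl | hne
  · have : (univ : Set X) = ∅ := by simpa using hcov.symm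
    refine Measure.le_iff.2 fun s _ => ?_
    have : s = ∅ := by rw [← subset_empty_iff, ← this]; exact subset_univ s
    simp [this]
  obtain ⟨e, he⟩ := hc.exists_eq_range hne
  set B : ℕ → Set X := fun n => interior (U (e n))
  have hB : ⋃ n, B n = univ := by
    rw [← hcov, he, biUnion_range]
  refine Measure.le_iff.2 fun s hs => ?_
  have hm : ∀ n, MeasurableSet (disjointed B n ∩ s) := fun n =>
    (MeasurableSet.disjointed (fun i => isOpen_interior.measurableSet) n).inter hs
  have hd : Pairwise (Function.onFun Disjoint fun n => disjointed B n ∩ s) := fun i j hij =>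
    (disjoint_disjointed B hij).mono inter_subset_left inter_subset_left
  have hsU : s = ⋃ n, disjointed B n ∩ s := by
    rw [← iUnion_inter, iUnion_disjointed, hB, univ_inter]
  calc μ s = ∑' n, μ (disjointed B n ∩ s) := by
        conv_lhs => rw [hsU]
        exact measure_iUnion hd hm
    _ ≤ ∑' n, ν (disjointed B n ∩ s) := by
        refine ENNReal.tsum_le_tsum fun n => hle (e n) _ ?_ (hm n)
        exact (inter_subset_left.trans (disjointed_subset B n)).trans interior_subset
    _ = ν s := by
        conv_rhs => rw [hsU]
        exact (measure_iUnion hd hm).symm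

variable {V E : Type*} [NormedAddCommGroup V] [InnerProductSpace ℝ V] [FiniteDimensional ℝ V]
  [MeasurableSpace V] [BorelSpace V] [NormedAddCommGroup E] [InnerProductSpace ℝ E]
  [MeasurableSpace E] [BorelSpace E]

-- Strict differentiability makes `f y - f z - L (y - z)` small compared with `‖y - z‖`, hence with
-- `‖L (y - z)‖`, because an injective linear map in finite dimension is bounded below.
omit [MeasurableSpace V] [BorelSpace V] [MeasurableSpace E] [BorelSpace E] in
theorem exists_nhds_edist_le {f : V → E} {L : V →L[ℝ] E} {x : V} (hf : HasStrictFDerivAt f L x)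
    (hL : Function.Injective L) {K : ℝ≥0} (hK : 1 < K) :
    ∃ U ∈ 𝓝 x, ∀ y ∈ U, ∀ z ∈ U, edist (f y) (f z) ≤ K * edist (L y) (L z) ∧
      edist (L y) (L z) ≤ K * edist (f y) (f z) := by
  obtain ⟨C, hC0, hC⟩ := L.toLinearMap.exists_antilipschitzWith (LinearMap.ker_eq_bot.2 hL)
  have hC' : ∀ v, ‖v‖ ≤ C * ‖L v‖ := fun v => by
    simpa using hC.le_mul_norm (map_zero _) v
  have hK' : (1 : ℝ) < K := by exact_mod_cast hK
  -- This `ε` serves both directions: `1 - ε = K⁻¹` exactly, and `1 + ε ≤ K` because `K + K⁻¹ ≥ 2`.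
  set ε : ℝ := 1 - (K : ℝ)⁻¹ with hε
  have hKi : (K : ℝ)⁻¹ < 1 := inv_lt_one_of_one_lt₀ hK'
  have hε0 : 0 < ε := by linarith
  have hεK : 1 + ε ≤ K := by
    have h1 : (K : ℝ) * (K : ℝ)⁻¹ = 1 := mul_inv_cancel₀ (by linarith)
    nlinarith [sq_nonneg ((K : ℝ) - 1), inv_pos.2 (by linarith : (0 : ℝ) < K)]
  have hC0' : (0 : ℝ) < C := by exact_mod_cast hC0
  have := hf.isLittleO.def (c := ε / C) (by positivity)
  rw [nhds_prod_eq] at this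
  obtain ⟨U, hU, hUU⟩ := mem_prod_self_iff.1 this
  refine ⟨U, hU, fun y hy z hz => ?_⟩
  have h1 : ‖f y - f z - L (y - z)‖ ≤ ε * ‖L (y - z)‖ := by
    refine (show ‖f y - f z - L (y - z)‖ ≤ ε / C * ‖y - z‖ from
      hUU (mk_mem_prod hy hz)).trans ?_
    calc ε / C * ‖y - z‖ ≤ ε / C * (C * ‖L (y - z)‖) := by gcongr; exact hC' _
      _ = ε * ‖L (y - z)‖ := by field_simp
  have h2 : ‖f y - f z‖ ≤ K * ‖L (y - z)‖ := by
    have := norm_sub_norm_le (f y - f z) (L (y - z))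
    nlinarith [norm_nonneg (L (y - z))]
  have h3 : ‖L (y - z)‖ ≤ K * ‖f y - f z‖ := by
    have h4 := norm_sub_norm_le (L (y - z)) (f y - f z)
    rw [norm_sub_rev (L (y - z))] at h4
    have h5 : (K : ℝ)⁻¹ * ‖L (y - z)‖ ≤ ‖f y - f z‖ := by
      rw [show (K : ℝ)⁻¹ = 1 - ε by rw [hε]; ring]; linarith
    rwa [inv_mul_le_iff₀ (by linarith)] at h5
  rw [map_sub] at h2 h3
  simp only [edist_eq_enorm_sub]
  constructor
  · have := ENNReal.ofReal_le_ofReal h2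
    rwa [ENNReal.ofReal_mul (by positivity), ofReal_norm, ofReal_norm,
      ENNReal.ofReal_coe_nnreal] at this
  · have := ENNReal.ofReal_le_ofReal h3
    rwa [ENNReal.ofReal_mul (by positivity), ofReal_norm, ofReal_norm,
      ENNReal.ofReal_coe_nnreal] at this

/-- The area formula for an injective immersion. -/
theorem map_withDensity_eq_restrict_range {f : V → E} {f' : V → V →L[ℝ] E} {W : V → ℝ≥0}
    (hf : MeasurableEmbedding f) (hf' : ∀ x, HasStrictFDerivAt f (f' x) x)
    (hW : Continuous W) (hpos : ∀ x, 0 < W x)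
    (hdet : ∀ x, (f' x).toLinearMap.normDet = W x) :
    Measure.map f (volume.withDensity fun x => (W x : ℝ≥0∞)) =
      (μHE[Module.finrank ℝ V] : Measure E).restrict (range f) := by
  set d := Module.finrank ℝ V
  suffices h : volume.withDensity (fun x => (W x : ℝ≥0∞)) = Measure.comap f μHE[d] by
    rw [h, hf.map_comap]
  have hinj : ∀ x, Function.Injective (f' x) := by
    intro x
    have h0 : (f' x).toLinearMap.normDet ≠ 0 := by rw [hdet]; exact_mod_cast (hpos x).ne'
    exact ((f' x).toLinearMap.normDet_ne_zero_tfae.out 0 4).1 h0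
  -- Of the `d + 1` factors `K`, the distortion of distances costs `d`, and replacing `W` by its
  -- value at one point costs the last. For the linear map `f' x` the formula is exact.
  have key : ∀ K : ℝ≥0, 1 < K →
      volume.withDensity (fun x => (W x : ℝ≥0∞)) ≤ (K : ℝ≥0∞) ^ (d + 1) • Measure.comap f μHE[d] ∧
      Measure.comap f μHE[d] ≤ (K : ℝ≥0∞) ^ (d + 1) •
        volume.withDensity (fun x => (W x : ℝ≥0∞)) := by
    intro K hK
    have hloc : ∀ x, ∃ U ∈ 𝓝 x, ∀ s ⊆ U, MeasurableSet s →
        volume.withDensity (fun x => (W x : ℝ≥0∞)) s ≤ (K : ℝ≥0∞) ^ (d + 1) * μHE[d] (f '' s) ∧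
        μHE[d] (f '' s) ≤ (K : ℝ≥0∞) ^ (d + 1) *
          volume.withDensity (fun x => (W x : ℝ≥0∞)) s := by
      intro x
      obtain ⟨U, hU, hUf⟩ := exists_nhds_edist_le (hf' x) (hinj x) hK
      have h1 : ∀ᶠ y in 𝓝 x, W y < K * W x :=
        hW.continuousAt.eventually_lt_const (lt_mul_of_one_lt_left (hpos x) hK)
      have h2 : ∀ᶠ y in 𝓝 x, W x < K * W y := by
        refine ((continuous_const.mul hW).tendsto x).eventually_const_lt ?_
        exact lt_mul_of_one_lt_left (hpos x) hK
      refine ⟨U ∩ {y | W y < K * W x ∧ W x < K * W y}, inter_mem hU (h1.and h2),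
        fun s hs hms => ?_⟩
      have hL : μHE[d] (f' x '' s) = W x * volume s := by
        have := (f' x).toLinearMap.euclideanHausdorffMeasure_image_eq_normDet_mul_volume s
        rw [hdet, ENNReal.ofReal_coe_nnreal] at this
        exact this
      have e1 := euclideanHausdorffMeasure_image_le_of_dist_le (a := f) (b := f' x) (s := s)
        (fun y hy z hz => (hUf y (hs hy).1 z (hs hz).1).1) d
      have e2 := euclideanHausdorffMeasure_image_le_of_dist_le (a := f' x) (b := f) (s := s)
        (fun y hy z hz => (hUf y (hs hy).1 z (hs hz).1).2) d
      rw [hL] at e1 e2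
      have e3 : volume.withDensity (fun x => (W x : ℝ≥0∞)) s ≤ K * (W x * volume s) := by
        rw [withDensity_apply _ hms, ← mul_assoc, ← setLIntegral_const]
        refine setLIntegral_mono measurable_const fun y hy => ?_
        exact_mod_cast (hs hy).2.1.le
      have e4 : W x * volume s ≤ K * volume.withDensity (fun x => (W x : ℝ≥0∞)) s := by
        rw [withDensity_apply _ hms, ← setLIntegral_const, ← lintegral_const_mul _
          (by fun_prop)]
        refine setLIntegral_mono (by fun_prop) fun y hy => ?_
        exact_mod_cast (hs hy).2.2.le
      constructor
      · calc _ ≤ _ := e3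
          _ ≤ K * ((K : ℝ≥0∞) ^ d * μHE[d] (f '' s)) := by gcongr
          _ = _ := by ring
      · calc _ ≤ _ := e1
          _ ≤ (K : ℝ≥0∞) ^ d * (K * volume.withDensity (fun x => (W x : ℝ≥0∞)) s) := by gcongr
          _ = _ := by ring
    constructor
    · refine measure_le_of_locally_le fun x => ?_
      obtain ⟨U, hU, h⟩ := hloc x
      refine ⟨U, hU, fun s hs hms => ?_⟩
      rw [Measure.smul_apply, smul_eq_mul, hf.comap_apply]
      simpa using (h s hs hms).1
    · refine measure_le_of_locally_le fun x => ?_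
      obtain ⟨U, hU, h⟩ := hloc x
      refine ⟨U, hU, fun s hs hms => ?_⟩
      rw [Measure.smul_apply, smul_eq_mul, hf.comap_apply]
      simpa using (h s hs hms).2
  -- Let `K` decrease to `1`.
  have lim : ∀ a b : ℝ≥0∞, (∀ K : ℝ≥0, 1 < K → a ≤ (K : ℝ≥0∞) ^ (d + 1) * b) → a ≤ b := by
    intro a b h
    rcases eq_or_ne b 0 with rfl | hb
    · simpa using h 2 (by norm_num)
    have ht : Tendsto (fun K : ℝ≥0 => (K : ℝ≥0∞) ^ (d + 1) * b) (𝓝[>] 1) (𝓝 (1 * b)) := by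
      refine ENNReal.Tendsto.mul_const ?_ (Or.inl one_ne_zero)
      have : Continuous fun K : ℝ≥0 => (K : ℝ≥0∞) ^ (d + 1) := by
        have h' : Continuous fun K : ℝ≥0 => ((K ^ (d + 1) : ℝ≥0) : ℝ≥0∞) := by fun_prop
        simpa using h'
      have h'' := (this.tendsto 1).mono_left (nhdsWithin_le_nhds (s := Ioi 1))
      simpa using h''
    rw [one_mul] at ht
    exact ge_of_tendsto ht (eventually_mem_nhdsWithin.mono fun K hK => h K hK)
  refine le_antisymm (Measure.le_iff.2 fun s hs => lim _ _ fun K hK => ?_)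
    (Measure.le_iff.2 fun s hs => lim _ _ fun K hK => ?_)
  · simpa using (key K hK).1 s
  · simpa using (key K hK).2 s

-- The hypothesis says `L* L = id + ⟨a, ·⟩ a`, a transvection, whose determinant is `1 + ‖a‖²`. Both
-- the graph map and its slices have derivatives of this kind.
omit [MeasurableSpace V] [BorelSpace V] [MeasurableSpace E] [BorelSpace E] in
theorem normDet_of_norm_sq [FiniteDimensional ℝ E] {L : V →L[ℝ] E} {a : V}
    (h : ∀ v w, ⟪L v, L w⟫_ℝ = ⟪v, w⟫_ℝ + ⟪a, v⟫_ℝ * ⟪a, w⟫_ℝ) :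
    L.toLinearMap.normDet = √(1 + ‖a‖ ^ 2) := by
  have h1 : (ContinuousLinearMap.adjoint L ∘SL L).toLinearMap =
      LinearMap.transvection (innerₗ V a) a := by
    ext v
    refine ext_inner_right ℝ fun w => ?_
    simp only [ContinuousLinearMap.coe_coe, ContinuousLinearMap.comp_apply,
      ContinuousLinearMap.adjoint_inner_left, h, LinearMap.transvection.apply, inner_add_left,
      inner_smul_left, innerₗ_apply_apply]
    simp
  have h2 := L.normDet_sq
  rw [ContinuousLinearMap.det, h1, LinearMap.transvection.det] at h2
  rw [eq_comm, Real.sqrt_eq_iff_eq_sq (by positivity) (LinearMap.normDet_nonneg _)]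
  simp only [innerₗ_apply_apply, real_inner_self_eq_norm_sq] at h2
  exact_mod_cast h2.symm

end AreaFormula

/-! ### The divergence theorem in a Euclidean space and in a half-space. -/

section Divergence

/-- Integration by parts against the constant `1`. -/
theorem integral_fderiv_apply_eq_zero {V : Type*} [NormedAddCommGroup V] [NormedSpace ℝ V]
    [FiniteDimensional ℝ V] [MeasurableSpace V] [BorelSpace V] (μ : Measure V)
    [μ.IsAddHaarMeasure] {F : V → ℝ} (hF : ContDiff ℝ 1 F) (hc : HasCompactSupport F) (v : V) :
    ∫ x, fderiv ℝ F x v ∂μ = 0 := by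
  have hF' : Continuous fun x => fderiv ℝ F x v :=
    (hF.continuous_fderiv one_ne_zero).clm_apply continuous_const
  have h := integral_mul_fderiv_eq_neg_fderiv_mul_of_integrable (μ := μ) (f := fun _ : V => (1 : ℝ))
    (g := F) (v := v) (by simp)
    (by simpa using hF'.integrable_of_hasCompactSupport (hc.fderiv_apply (𝕜 := ℝ) v))
    (by simpa using hF.continuous.integrable_of_hasCompactSupport hc)
    (fun x _ => by fun_prop) (fun x _ => hF.differentiable one_ne_zero x)
  simpa using h

/-- The divergence of a vector field. -/
noncomputable def divergence {V : Type*} [NormedAddCommGroup V] [NormedSpace ℝ V]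
    (F : V → V) (x : V) : ℝ := LinearMap.trace ℝ V (fderiv ℝ F x).toLinearMap

theorem continuous_divergence {V : Type*} [NormedAddCommGroup V] [NormedSpace ℝ V]
    [FiniteDimensional ℝ V] {F : V → V} (hF : ContDiff ℝ 1 F) : Continuous (divergence F) := by
  have h : Continuous fun L : V →L[ℝ] V => LinearMap.trace ℝ V L.toLinearMap :=
    LinearMap.continuous_of_finiteDimensional
      ((LinearMap.trace ℝ V).comp (ContinuousLinearMap.coeLM ℝ))
  exact h.comp (hF.continuous_fderiv one_ne_zero)

theorem hasCompactSupport_divergence {V : Type*} [NormedAddCommGroup V] [NormedSpace ℝ V]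
    {F : V → V} (hc : HasCompactSupport F) : HasCompactSupport (divergence F) :=
  (hc.fderiv (𝕜 := ℝ)).comp_left (g := fun L : V →L[ℝ] V => LinearMap.trace ℝ V L.toLinearMap)
    (by simp)

theorem integral_divergence_eq_zero {V : Type*} [NormedAddCommGroup V] [InnerProductSpace ℝ V]
    [FiniteDimensional ℝ V] [MeasurableSpace V] [BorelSpace V] {F : V → V}
    (hF : ContDiff ℝ 1 F) (hc : HasCompactSupport F) : ∫ x, divergence F x = 0 := by
  set b := stdOrthonormalBasis ℝ V
  have hi : ∀ i, ContDiff ℝ 1 fun x => ⟪b i, F x⟫_ℝ := fun i => contDiff_const.inner ℝ hF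
  have hci : ∀ i, HasCompactSupport fun x => ⟪b i, F x⟫_ℝ := fun i =>
    hc.comp_left (g := fun y => ⟪b i, y⟫_ℝ) (by simp)
  have h : ∀ x, divergence F x = ∑ i, fderiv ℝ (fun x => ⟪b i, F x⟫_ℝ) x (b i) := by
    intro x
    rw [divergence, LinearMap.trace_eq_sum_inner _ b]
    refine Finset.sum_congr rfl fun i _ => ?_
    rw [fderiv_inner_apply ℝ (by fun_prop) (hF.differentiable one_ne_zero x)]
    simp
  simp_rw [h]
  rw [integral_finsetSum]
  · exact Finset.sum_eq_zero fun i _ => integral_fderiv_apply_eq_zero volume (hi i) (hci i) (b i)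
  · intro i _
    exact (((hi i).continuous_fderiv one_ne_zero).clm_apply continuous_const
      ).integrable_of_hasCompactSupport ((hci i).fderiv_apply (𝕜 := ℝ) (b i))

variable {Z : Type*} [NormedAddCommGroup Z] [InnerProductSpace ℝ Z] [FiniteDimensional ℝ Z]

/-- The inclusion of the first factor into an orthogonal sum. -/
noncomputable def inlL (Z : Type*) [NormedAddCommGroup Z] [InnerProductSpace ℝ Z] :
    Z →L[ℝ] WithLp 2 (Z × ℝ) :=
  (WithLp.prodContinuousLinearEquiv 2 ℝ Z ℝ).symm.toContinuousLinearMap ∘L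
    ContinuousLinearMap.inl ℝ Z ℝ

/-- The inclusion of the second factor into an orthogonal sum. -/
noncomputable def inrL (Z : Type*) [NormedAddCommGroup Z] [InnerProductSpace ℝ Z] :
    ℝ →L[ℝ] WithLp 2 (Z × ℝ) :=
  (WithLp.prodContinuousLinearEquiv 2 ℝ Z ℝ).symm.toContinuousLinearMap ∘L
    ContinuousLinearMap.inr ℝ Z ℝ

omit [FiniteDimensional ℝ Z] in
@[simp] theorem inlL_apply (z : Z) : inlL Z z = WithLp.toLp 2 (z, 0) := rfl

omit [FiniteDimensional ℝ Z] in
@[simp] theorem inrL_apply (s : ℝ) : inrL Z s = WithLp.toLp 2 (0, s) := rfl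

omit [FiniteDimensional ℝ Z] in
theorem inlL_add_inrL (z : Z) (s : ℝ) : inlL Z z + inrL Z s = WithLp.toLp 2 (z, s) := by
  simp [← WithLp.toLp_add]

/-- Write `L` as a sum of two maps factoring through the summands and use `tr (AB) = tr (BA)`. It
splits the divergence into a horizontal part and a derivative in the last variable. -/
theorem trace_prod_eq (L : WithLp 2 (Z × ℝ) →L[ℝ] WithLp 2 (Z × ℝ)) :
    LinearMap.trace ℝ _ L.toLinearMap =
      LinearMap.trace ℝ Z (WithLp.fstL 2 ℝ Z ℝ ∘L L ∘L inlL Z).toLinearMap +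
        (L (WithLp.toLp 2 (0, 1))).snd := by
  have h : L.toLinearMap = (L ∘L inlL Z).toLinearMap ∘ₗ (WithLp.fstL 2 ℝ Z ℝ).toLinearMap +
      (L ∘L inrL Z).toLinearMap ∘ₗ (WithLp.sndL 2 ℝ Z ℝ).toLinearMap := by
    ext1 x
    obtain ⟨z, s⟩ := x
    change L (WithLp.toLp 2 (z, s)) = L (inlL Z z) + L (inrL Z s)
    rw [← map_add, inlL_add_inrL]
  rw [h, map_add, LinearMap.trace_comp_comm' (WithLp.fstL 2 ℝ Z ℝ).toLinearMap,
    LinearMap.trace_comp_comm' (WithLp.sndL 2 ℝ Z ℝ).toLinearMap]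
  congr 1
  rw [LinearMap.trace_eq_sum_inner _ (OrthonormalBasis.singleton Unit ℝ)]
  simp

theorem isClosedEmbedding_toLp_left (s : ℝ) :
    IsClosedEmbedding fun z : Z => (WithLp.toLp 2 (z, s) : WithLp 2 (Z × ℝ)) :=
  (Isometry.of_dist_eq fun x y => by
    simp [WithLp.prod_dist_eq_of_L2, Real.sqrt_sq]).isClosedEmbedding

/-- By Fubini the horizontal divergence integrates to zero on every level, while the remaining
derivative is integrated along `Iic t` by the fundamental theorem of calculus. -/
theorem setIntegral_divergence_halfspace [MeasurableSpace Z] [BorelSpace Z]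
    {F : WithLp 2 (Z × ℝ) → WithLp 2 (Z × ℝ)} (hF : ContDiff ℝ 1 F) (hc : HasCompactSupport F)
    (t : ℝ) :
    ∫ x in {x | x.snd ≤ t}, divergence F x = ∫ z, (F (WithLp.toLp 2 (z, t))).snd := by
  set e := (WithLp.prodContinuousLinearEquiv 2 ℝ Z ℝ).symm
  have hmp := (WithLp.volume_preserving_ofLp Z ℝ)
  have hF1 : ∀ s, ContDiff ℝ 1 fun z => (F (WithLp.toLp 2 (z, s))).fst := fun s =>
    (WithLp.fstL 2 ℝ Z ℝ).contDiff.comp (hF.comp (e.contDiff.comp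
      (contDiff_id.prodMk contDiff_const)))
  have hF2 : ∀ z, ContDiff ℝ 1 fun s => (F (WithLp.toLp 2 (z, s))).snd := fun z =>
    (WithLp.sndL 2 ℝ Z ℝ).contDiff.comp (hF.comp (e.contDiff.comp
      (contDiff_const.prodMk contDiff_id)))
  have hcl2 : ∀ z, IsClosedEmbedding fun s : ℝ => (WithLp.toLp 2 (z, s) : WithLp 2 (Z × ℝ)) :=
    fun z => (Isometry.of_dist_eq fun x y => by
      simp [WithLp.prod_dist_eq_of_L2, Real.sqrt_sq]).isClosedEmbedding
  have hc1 : ∀ s, HasCompactSupport fun z => (F (WithLp.toLp 2 (z, s))).fst := fun s =>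
    (hc.comp_isClosedEmbedding (isClosedEmbedding_toLp_left s)).comp_left (g := WithLp.fst) rfl
  have hc2 : ∀ z, HasCompactSupport fun s => (F (WithLp.toLp 2 (z, s))).snd := fun z =>
    (hc.comp_isClosedEmbedding (hcl2 z)).comp_left (g := WithLp.snd) rfl
  have hFd : ∀ x, HasFDerivAt F (fderiv ℝ F x) x := fun x =>
    (hF.differentiable one_ne_zero x).hasFDerivAt
  have hd1 : ∀ z s, LinearMap.trace ℝ Z (WithLp.fstL 2 ℝ Z ℝ ∘L
      fderiv ℝ F (WithLp.toLp 2 (z, s)) ∘L inlL Z).toLinearMap =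
      divergence (fun z => (F (WithLp.toLp 2 (z, s))).fst) z := by
    intro z s
    have h1 : HasFDerivAt (fun z : Z => (WithLp.toLp 2 (z, s) : WithLp 2 (Z × ℝ))) (inlL Z) z := by
      have := ((inlL Z).hasFDerivAt (x := z)).add_const (inrL Z s)
      refine this.congr_of_eventuallyEq (Eventually.of_forall fun y => ?_)
      exact (inlL_add_inrL y s).symm
    have h2 := ((WithLp.fstL 2 ℝ Z ℝ).hasFDerivAt.comp _ ((hFd (WithLp.toLp 2 (z, s))).comp z h1))
    rw [divergence, ← h2.fderiv]
    rfl
  have hd2 : ∀ z s, (fderiv ℝ F (WithLp.toLp 2 (z, s)) (WithLp.toLp 2 (0, 1))).snd =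
      deriv (fun s => (F (WithLp.toLp 2 (z, s))).snd) s := by
    intro z s
    have h1 : HasFDerivAt (fun s : ℝ => (WithLp.toLp 2 (z, s) : WithLp 2 (Z × ℝ))) (inrL Z) s := by
      have := ((inrL Z).hasFDerivAt (x := s)).const_add (inlL Z z)
      refine this.congr_of_eventuallyEq (Eventually.of_forall fun y => ?_)
      exact (inlL_add_inrL z y).symm
    have h2 := ((WithLp.sndL 2 ℝ Z ℝ).hasFDerivAt.comp _ ((hFd (WithLp.toLp 2 (z, s))).comp s h1))
    have h3 := h2.hasDerivAt.deriv
    exact h3.symm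
  have hsplit : ∀ p : Z × ℝ, divergence F (WithLp.toLp 2 p) =
      divergence (fun z => (F (WithLp.toLp 2 (z, p.2))).fst) p.1 +
        deriv (fun s => (F (WithLp.toLp 2 (p.1, s))).snd) p.2 := by
    rintro ⟨z, s⟩
    rw [divergence, trace_prod_eq, hd1, hd2]
  have hint : ∀ G : WithLp 2 (Z × ℝ) → ℝ, Continuous G → HasCompactSupport G →
      Integrable (fun p : Z × ℝ => G (WithLp.toLp 2 p)) (volume.prod volume) := by
    intro G hG hGc
    exact (hG.comp e.continuous).integrable_of_hasCompactSupport
      (hGc.comp_homeomorph e.toHomeomorph)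
  have hcf := hc.fderiv (𝕜 := ℝ)
  have hci := hF.continuous_fderiv one_ne_zero
  have hI2 : Integrable (fun p : Z × ℝ => deriv (fun s => (F (WithLp.toLp 2 (p.1, s))).snd) p.2)
      (volume.prod volume) := by
    simp_rw [← hd2]
    refine hint (fun x => (fderiv ℝ F x (WithLp.toLp 2 (0, 1))).snd) ?_ ?_
    · exact (WithLp.sndL 2 ℝ Z ℝ).continuous.comp (hci.clm_apply continuous_const)
    · exact hcf.comp_left (g := fun L : WithLp 2 (Z × ℝ) →L[ℝ] WithLp 2 (Z × ℝ) =>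
        (L (WithLp.toLp 2 (0, 1))).snd) (by simp)
  have hI : Integrable (fun p : Z × ℝ => divergence F (WithLp.toLp 2 p)) (volume.prod volume) :=
    hint _ (continuous_divergence hF) (hasCompactSupport_divergence hc)
  have hI1 : Integrable (fun p : Z × ℝ =>
      divergence (fun z => (F (WithLp.toLp 2 (z, p.2))).fst) p.1) (volume.prod volume) := by
    refine (hI.sub hI2).congr (Eventually.of_forall fun p => ?_)
    simp [hsplit]
  have hset : {x : WithLp 2 (Z × ℝ) | x.snd ≤ t} = WithLp.ofLp ⁻¹' (univ ×ˢ Iic t) := by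
    ext x; simp
  have hemb : MeasurableEmbedding (WithLp.ofLp : WithLp 2 (Z × ℝ) → Z × ℝ) :=
    (MeasurableEquiv.toLp 2 (Z × ℝ)).symm.measurableEmbedding
  rw [hset, ← integral_indicator (hemb.measurable (MeasurableSet.univ.prod measurableSet_Iic))]
  have h0 := hmp.integral_comp hemb
    (g := (univ ×ˢ Iic t).indicator fun p => divergence F (WithLp.toLp 2 p))
  have h0' : (∫ x, (WithLp.ofLp ⁻¹' (univ ×ˢ Iic t)).indicator (divergence F) x) =
      ∫ x : WithLp 2 (Z × ℝ), (univ ×ˢ Iic t).indicator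
        (fun p => divergence F (WithLp.toLp 2 p)) x.ofLp := rfl
  rw [h0', h0, integral_indicator (MeasurableSet.univ.prod measurableSet_Iic),
    show (volume : Measure (Z × ℝ)) = volume.prod volume from rfl]
  simp_rw [hsplit]
  rw [integral_add hI1.integrableOn hI2.integrableOn]
  have e1 : ∫ p in univ ×ˢ Iic t, divergence (fun z => (F (WithLp.toLp 2 (z, p.2))).fst) p.1
      ∂((volume : Measure Z).prod (volume : Measure ℝ)) = 0 := by
    rw [← setIntegral_prod_swap]
    refine (setIntegral_prod _ hI1.swap.integrableOn).trans ?_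
    simp [integral_divergence_eq_zero (hF1 _) (hc1 _)]
  rw [e1, zero_add, setIntegral_prod _ hI2.integrableOn]
  simp [HasCompactSupport.integral_Iic_deriv_eq (hF2 _) (hc2 _)]

end Divergence

/-! ### Minimal graphs and the divergence of the flux field. -/

section GraphCalculus

variable {V : Type*} [NormedAddCommGroup V] [InnerProductSpace ℝ V] [CompleteSpace V]

/-- The area element of the graph of `u`. -/
noncomputable def areaElement (u : V → ℝ) (x : V) : ℝ := √(1 + ‖∇ u x‖ ^ 2)

/-- The horizontal part of the unit normal of the graph of `u`, up to sign. -/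
noncomputable def normalPart (u : V → ℝ) (x : V) : V := (areaElement u x)⁻¹ • ∇ u x

/-- The tangential part of the constant vector field `a` on the graph of `u`, as a vector field on
the base, weighted with the area element. -/
noncomputable def flux (u : V → ℝ) (a : WithLp 2 (V × ℝ)) (x : V) : V :=
  areaElement u x • a.fst + (a.snd - ⟪∇ u x, a.fst⟫_ℝ) • normalPart u x

theorem areaElement_pos (u : V → ℝ) (x : V) : 0 < areaElement u x := by
  unfold areaElement; positivity

theorem areaElement_sq (u : V → ℝ) (x : V) : areaElement u x ^ 2 = 1 + ‖∇ u x‖ ^ 2 :=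
  Real.sq_sqrt (by positivity)

theorem contDiff_gradient {u : V → ℝ} (hu : ContDiff ℝ ∞ u) : ContDiff ℝ ∞ (∇ u) :=
  (InnerProductSpace.toDual ℝ V).symm.contDiff.comp (hu.fderiv_right (by simp))

theorem inner_gradient_eq (u : V → ℝ) (x v : V) : ⟪∇ u x, v⟫_ℝ = fderiv ℝ u x v := by
  simp [gradient]

theorem contDiff_areaElement {u : V → ℝ} (hu : ContDiff ℝ ∞ u) : ContDiff ℝ ∞ (areaElement u) :=
  (contDiff_const.add ((contDiff_gradient hu).norm_sq ℝ)).sqrt fun x => by positivity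

theorem contDiff_normalPart {u : V → ℝ} (hu : ContDiff ℝ ∞ u) : ContDiff ℝ ∞ (normalPart u) :=
  ((contDiff_areaElement hu).inv fun x => (areaElement_pos u x).ne').smul (contDiff_gradient hu)

theorem contDiff_flux {u : V → ℝ} (hu : ContDiff ℝ ∞ u) (a : WithLp 2 (V × ℝ)) :
    ContDiff ℝ ∞ (flux u a) :=
  ((contDiff_areaElement hu).smul contDiff_const).add
    ((contDiff_const.sub ((contDiff_gradient hu).inner ℝ contDiff_const)).smul
      (contDiff_normalPart hu))

theorem inner_fderiv_gradient_comm {u : V → ℝ} (hu : ContDiff ℝ ∞ u) (x v w : V) :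
    ⟪fderiv ℝ (∇ u) x v, w⟫_ℝ = ⟪fderiv ℝ (∇ u) x w, v⟫_ℝ := by
  have hd : ∀ y, DifferentiableAt ℝ (∇ u) y := (contDiff_gradient hu).differentiable (by simp)
  have h := second_derivative_symmetric (f := u)
    (f' := fun y => InnerProductSpace.toDual ℝ V (∇ u y))
    (f'' := (InnerProductSpace.toDual ℝ V).toContinuousLinearEquiv.toContinuousLinearMap ∘L
      fderiv ℝ (∇ u) x) (x := x)
    (fun y => by
      simpa [gradient] using (hu.differentiable (by simp) y).hasFDerivAt)
    ((InnerProductSpace.toDual ℝ V).toContinuousLinearEquiv.hasFDerivAt.comp x (hd x).hasFDerivAt)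
    v w
  simpa using h

/-- If the mean curvature of a graph vanishes, then the tangential parts of constant vector fields
are divergence free. -/
theorem divergence_flux_eq_zero [FiniteDimensional ℝ V] {u : V → ℝ} (hu : ContDiff ℝ ∞ u)
    (a : WithLp 2 (V × ℝ)) {x : V} (hx : divergence (normalPart u) x = 0) :
    divergence (flux u a) x = 0 := by
  set G' := fderiv ℝ (∇ u) x
  have hG : HasFDerivAt (∇ u) G' x :=
    ((contDiff_gradient hu).differentiable (by simp) x).hasFDerivAt
  have hX : HasFDerivAt (normalPart u) (fderiv ℝ (normalPart u) x) x :=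
    ((contDiff_normalPart hu).differentiable (by simp) x).hasFDerivAt
  have hW0 := areaElement_pos u x
  have hW : HasFDerivAt (areaElement u)
      ((areaElement u x)⁻¹ • (innerSL ℝ (∇ u x) ∘L G')) x := by
    have h1 := ((hG.norm_sq.const_add 1).sqrt (by positivity : 1 + ‖∇ u x‖ ^ 2 ≠ 0))
    refine h1.congr_fderiv ?_
    ext v
    change 1 / (2 * areaElement u x) * (2 • ⟪∇ u x, G' v⟫_ℝ) =
      (areaElement u x)⁻¹ * ⟪∇ u x, G' v⟫_ℝ
    rw [nsmul_eq_mul]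
    field_simp
    norm_num
  have hI : HasFDerivAt (fun y => a.snd - ⟪∇ u y, a.fst⟫_ℝ) (-(innerSL ℝ a.fst ∘L G')) x := by
    have h1 := ((innerSL ℝ a.fst).hasFDerivAt.comp x hG).const_sub a.snd
    refine h1.congr_of_eventuallyEq (Eventually.of_forall fun y => ?_)
    simp [real_inner_comm]
  have hA := (hW.smul_const a.fst).add (hI.smul hX)
  have hA' : fderiv ℝ (flux u a) x = _ := hA.fderiv
  have hx' : LinearMap.trace ℝ V (fderiv ℝ (normalPart u) x).toLinearMap = 0 := hx
  rw [divergence, hA']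
  -- By the product rule the divergence has three terms. The one containing `div (normalPart u)`
  -- vanishes by hypothesis; the other two, computed in `e1` and `e2`, are `±W⁻¹` times the Hessian
  -- evaluated on `∇u` and `a.fst`, and cancel by its symmetry.
  have e1 : LinearMap.trace ℝ V
      ((((areaElement u x)⁻¹ • (innerSL ℝ (∇ u x) ∘L G')).smulRight a.fst)).toLinearMap =
      (areaElement u x)⁻¹ * ⟪∇ u x, G' a.fst⟫_ℝ := by
    exact LinearMap.trace_smulRight
      ((areaElement u x)⁻¹ • (innerSL ℝ (∇ u x) ∘L G')).toLinearMap a.fst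
  have e2 : LinearMap.trace ℝ V
      ((-(innerSL ℝ a.fst ∘L G')).smulRight (normalPart u x)).toLinearMap =
      -((areaElement u x)⁻¹ * ⟪a.fst, G' (∇ u x)⟫_ℝ) := by
    refine (LinearMap.trace_smulRight (-(innerSL ℝ a.fst ∘L G')).toLinearMap _).trans ?_
    change -⟪a.fst, G' (normalPart u x)⟫_ℝ = _
    rw [normalPart, map_smul, real_inner_smul_right]
  simp only [ContinuousLinearMap.toLinearMap_add, ContinuousLinearMap.toLinearMap_smul, map_add,
    map_smul, hx', e1, e2]
  rw [real_inner_comm, real_inner_comm (G' (∇ u x)), inner_fderiv_gradient_comm hu]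
  simp [G']

omit [CompleteSpace V] in
theorem divergence_smul [FiniteDimensional ℝ V] {ψ : V → ℝ} {A : V → V} {x : V}
    (hψ : DifferentiableAt ℝ ψ x) (hA : DifferentiableAt ℝ A x) :
    divergence (fun y => ψ y • A y) x = ψ x * divergence A x + fderiv ℝ ψ x (A x) := by
  have h : fderiv ℝ (fun y => ψ y • A y) x = _ := (hψ.hasFDerivAt.smul hA.hasFDerivAt).fderiv
  rw [divergence, h, ContinuousLinearMap.toLinearMap_add, map_add, ContinuousLinearMap.toLinearMap_smul, map_smul]
  exact congrArg _ (LinearMap.trace_smulRight (fderiv ℝ ψ x).toLinearMap (A x))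

end GraphCalculus

/-! ### Geometry of a graph: normal, tangent cone, mean curvature. -/

section GraphMap

variable {V E : Type*} [NormedAddCommGroup V] [InnerProductSpace ℝ V]
  [NormedAddCommGroup E] [InnerProductSpace ℝ E]

/-- The parametrization of the graph of `u` in an ambient space that is identified with `V × ℝ`. -/
noncomputable def graphMap (R : WithLp 2 (V × ℝ) ≃ₗᵢ[ℝ] E) (u : V → ℝ) (x : V) : E := R (WithLp.toLp 2 (x, u x))

/-- A normal vector field of the graph of `u`. -/
noncomputable def graphNormal [CompleteSpace V] (R : WithLp 2 (V × ℝ) ≃ₗᵢ[ℝ] E) (u : V → ℝ)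
    (x : V) : E :=
  R (WithLp.toLp 2 (-∇ u x, 1))

/-- The projection of the ambient space to the base. -/
noncomputable def baseProj (R : WithLp 2 (V × ℝ) ≃ₗᵢ[ℝ] E) : E →L[ℝ] V :=
  WithLp.fstL 2 ℝ V ℝ ∘L R.symm.toContinuousLinearEquiv.toContinuousLinearMap

variable (R : WithLp 2 (V × ℝ) ≃ₗᵢ[ℝ] E) {u : V → ℝ}

theorem baseProj_apply (q : E) : baseProj R q = (R.symm q).fst := rfl

@[simp] theorem baseProj_graphMap (x : V) : baseProj R (graphMap R u x) = x := by
  simp [baseProj_apply, graphMap]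

/-- The function whose zero set is the graph of `u`. -/
noncomputable def graphDefiningFunction (R : WithLp 2 (V × ℝ) ≃ₗᵢ[ℝ] E) (u : V → ℝ) (q : E) : ℝ :=
  (R.symm q).snd - u (R.symm q).fst

@[simp] theorem graphDefiningFunction_graphMap (x : V) :
    graphDefiningFunction R u (graphMap R u x) = 0 := by
  simp [graphDefiningFunction, graphMap]

theorem mem_range_graphMap {q : E} :
    q ∈ range (graphMap R u) ↔ (R.symm q).snd = u (R.symm q).fst := by
  constructor
  · rintro ⟨x, rfl⟩
    simp [graphMap]
  · intro h
    refine ⟨(R.symm q).fst, ?_⟩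
    rw [graphMap, ← h]
    exact R.apply_symm_apply q

theorem contDiff_graphMap {n : WithTop ℕ∞} (hu : ContDiff ℝ n u) :
    ContDiff ℝ n (graphMap R u) :=
  R.contDiff.comp ((WithLp.prodContinuousLinearEquiv 2 ℝ V ℝ).symm.contDiff.comp
    (contDiff_id.prodMk hu))

theorem isClosedEmbedding_graphMap (hu : Continuous u) : IsClosedEmbedding (graphMap R u) := by
  have hc : Continuous (graphMap R u) :=
    R.continuous.comp ((WithLp.prod_continuous_toLp 2 V ℝ).comp (continuous_id.prodMk hu))
  have hr : range (graphMap R u) = {q | (R.symm q).snd = u (R.symm q).fst} :=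
    Set.ext fun q => mem_range_graphMap R
  refine ⟨⟨⟨?_⟩, fun x y h => ?_⟩, ?_⟩
  · exact (Topology.IsInducing.of_comp hc (baseProj R).continuous
      (by
        rw [show baseProj R ∘ graphMap R u = id from funext (baseProj_graphMap R)]
        exact Topology.IsInducing.id)).eq_induced
  · simpa using congrArg (baseProj R) h
  · rw [hr]
    exact isClosed_eq ((WithLp.sndL 2 ℝ V ℝ).continuous.comp R.symm.continuous)
      (hu.comp (baseProj R).continuous)

theorem hasFDerivAt_graphMap {x : V} (hu : DifferentiableAt ℝ u x) :
    HasFDerivAt (graphMap R u)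
      (R.toContinuousLinearEquiv.toContinuousLinearMap ∘L
        (WithLp.prodContinuousLinearEquiv 2 ℝ V ℝ).symm.toContinuousLinearMap ∘L
        (ContinuousLinearMap.id ℝ V).prod (fderiv ℝ u x)) x :=
  R.toContinuousLinearEquiv.hasFDerivAt.comp x
    ((WithLp.prodContinuousLinearEquiv 2 ℝ V ℝ).symm.hasFDerivAt.comp x
      ((hasFDerivAt_id x).prodMk hu.hasFDerivAt))

theorem fderiv_graphMap_apply {x : V} (hu : DifferentiableAt ℝ u x) (v : V) :
    fderiv ℝ (graphMap R u) x v = R (WithLp.toLp 2 (v, fderiv ℝ u x v)) := by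
  rw [(hasFDerivAt_graphMap R hu).fderiv]; rfl

section

variable [CompleteSpace V]

theorem inner_graphNormal (x : V) (e : E) :
    ⟪graphNormal R u x, e⟫_ℝ = (R.symm e).snd - ⟪∇ u x, (R.symm e).fst⟫_ℝ := by
  obtain ⟨a, rfl⟩ := R.surjective e
  rw [graphNormal, R.inner_map_map, WithLp.prod_inner_apply]
  simp
  ring

theorem norm_graphNormal (x : V) : ‖graphNormal R u x‖ = areaElement u x := by
  rw [graphNormal, R.norm_map, WithLp.prod_norm_eq_of_L2, areaElement]
  simp [add_comm]

theorem hasGradientAt_graphDefiningFunction [CompleteSpace E] {q : E}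
    (hu : DifferentiableAt ℝ u (baseProj R q)) :
    HasGradientAt (graphDefiningFunction R u) (graphNormal R u (baseProj R q)) q := by
  rw [hasGradientAt_iff_hasFDerivAt]
  have h1 : HasFDerivAt (graphDefiningFunction R u) _ q :=
    ((WithLp.sndL 2 ℝ V ℝ ∘L R.symm.toContinuousLinearEquiv.toContinuousLinearMap).hasFDerivAt.sub
      (hu.hasFDerivAt.comp q (baseProj R).hasFDerivAt))
  refine h1.congr_fderiv ?_
  ext v
  rw [InnerProductSpace.toDual_apply_apply, inner_graphNormal, inner_gradient_eq]
  rfl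

/-- The defining function maps the graph to a single point, so its derivative kills the tangent
cone. Conversely, the derivative of the parametrization sends every base vector into the cone, and
these images fill the hyperplane. -/
theorem tangentConeAt_range_graphMap [CompleteSpace E] {x : V} (hu : DifferentiableAt ℝ u x) :
    tangentConeAt ℝ (range (graphMap R u)) (graphMap R u x) =
      {v | ⟪graphNormal R u x, v⟫_ℝ = 0} := by
  ext v
  constructor
  · intro hv
    have hg := (hasGradientAt_graphDefiningFunction R (u := u) (q := graphMap R u x)
      (by simpa using hu)).hasFDerivAt
    have h := hg.hasFDerivWithinAt.mapsTo_tangent_cone hv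
    have h0 : ¬AccPt (graphDefiningFunction R u (graphMap R u x))
        (𝓟 (graphDefiningFunction R u '' range (graphMap R u))) := by
      have : graphDefiningFunction R u '' range (graphMap R u) ⊆ {0} := by
        rintro _ ⟨_, ⟨y, rfl⟩, rfl⟩
        simp
      intro hacc
      have h1 := hacc.mono (principal_mono.2 this)
      rw [graphDefiningFunction_graphMap, accPt_iff_nhds] at h1
      obtain ⟨y, hy, hy0⟩ := h1 univ univ_mem
      exact hy0 hy.2
    have h2 := tangentConeAt_subset_zero h0 h
    simpa using h2
  · intro hv
    have h := (hasFDerivAt_graphMap R hu).hasFDerivWithinAt (s := univ) |>.mapsTo_tangent_cone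
    rw [tangentConeAt_univ, image_univ] at h
    have h1 := h (mem_univ (R.symm v).fst)
    convert h1 using 1
    have hv' : (R.symm v).snd = fderiv ℝ u x (R.symm v).fst := by
      have : ⟪graphNormal R u x, v⟫_ℝ = 0 := hv
      rw [inner_graphNormal, inner_gradient_eq] at this
      linarith
    change v = R (WithLp.toLp 2 ((R.symm v).fst, fderiv ℝ u x (R.symm v).fst))
    rw [← hv']
    exact (R.apply_symm_apply v).symm

/-- The unit normal field is `n ∘ π` with `π` the base projection, and `normalPart u = -(π ∘ n)`.
The two derivatives are products of the same factors in opposite order, hence have the same trace up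
to sign. -/
theorem divergence_normalPart [FiniteDimensional ℝ V] [FiniteDimensional ℝ E]
    (hu : ContDiff ℝ ∞ u) (q : E) :
    divergence (normalPart u) (baseProj R q) =
      -LinearMap.trace ℝ E (fderiv ℝ (fun y => ‖∇ (graphDefiningFunction R u) y‖⁻¹ •
        ∇ (graphDefiningFunction R u) y) q).toLinearMap := by
  set n : V → E := fun x => (areaElement u x)⁻¹ • graphNormal R u x with hn
  have hdu : Differentiable ℝ u := hu.differentiable (by simp)
  have h1 : (fun y => ‖∇ (graphDefiningFunction R u) y‖⁻¹ • ∇ (graphDefiningFunction R u) y) =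
      n ∘ baseProj R := by
    ext1 y
    rw [(hasGradientAt_graphDefiningFunction R (hdu _)).gradient, norm_graphNormal]
    rfl
  have hnd : ContDiff ℝ ∞ n := by
    refine ((contDiff_areaElement hu).inv fun x => (areaElement_pos u x).ne').smul ?_
    exact R.contDiff.comp ((WithLp.prodContinuousLinearEquiv 2 ℝ V ℝ).symm.contDiff.comp
      ((contDiff_gradient hu).neg.prodMk contDiff_const))
  have hn' : HasFDerivAt n (fderiv ℝ n (baseProj R q)) (baseProj R q) :=
    (hnd.differentiable (by simp) _).hasFDerivAt
  have h2 : normalPart u = -(baseProj R ∘ n) := by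
    ext1 x
    simp [hn, normalPart, graphNormal, baseProj_apply]
  rw [h1, (hn'.comp q (baseProj R).hasFDerivAt).fderiv, divergence, h2,
    ((baseProj R).hasFDerivAt.comp _ hn').neg.fderiv]
  rw [ContinuousLinearMap.toLinearMap_neg, map_neg, ContinuousLinearMap.toLinearMap_comp,
    ContinuousLinearMap.toLinearMap_comp, LinearMap.trace_comp_comm']

end

end GraphMap

/-! ### Graph charts of a hypersurface. -/

section Charts

variable {k : ℕ} {V : Type*} [NormedAddCommGroup V] [InnerProductSpace ℝ V]
  [FiniteDimensional ℝ V] [CompleteSpace V]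

/-- In the open set `U`, the set `M` is the graph of the smooth function `u`. -/
structure IsGraphChart (M U : Set (Space k)) (R : WithLp 2 (V × ℝ) ≃ₗᵢ[ℝ] Space k)
    (u : V → ℝ) : Prop where
  isOpen : IsOpen U
  contDiff : ContDiff ℝ ∞ u
  mem_iff : ∀ q ∈ U, q ∈ M ↔ (R.symm q).snd = u (R.symm q).fst

variable {M U : Set (Space k)} {R : WithLp 2 (V × ℝ) ≃ₗᵢ[ℝ] Space k} {u : V → ℝ}

omit [FiniteDimensional ℝ V] [CompleteSpace V] in
theorem IsGraphChart.mono (h : IsGraphChart M U R u) {U' : Set (Space k)} (hU' : IsOpen U')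
    (hs : U' ⊆ U) : IsGraphChart M U' R u :=
  ⟨hU', h.contDiff, fun q hq => h.mem_iff q (hs hq)⟩

omit [FiniteDimensional ℝ V] [CompleteSpace V] in
theorem IsGraphChart.mem_iff_range (h : IsGraphChart M U R u) {q : Space k} (hq : q ∈ U) :
    q ∈ M ↔ q ∈ range (graphMap R u) := by
  rw [h.mem_iff q hq, mem_range_graphMap]

omit [FiniteDimensional ℝ V] [CompleteSpace V] in
theorem IsGraphChart.graphMap_mem (h : IsGraphChart M U R u) {x : V}
    (hq : graphMap R u x ∈ U) : graphMap R u x ∈ M :=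
  (h.mem_iff_range hq).2 ⟨x, rfl⟩

omit [FiniteDimensional ℝ V] [CompleteSpace V] in
theorem IsGraphChart.graphMap_baseProj (h : IsGraphChart M U R u) {q : Space k}
    (hq : q ∈ U) (hqM : q ∈ M) : graphMap R u (baseProj R q) = q := by
  obtain ⟨x, rfl⟩ := (h.mem_iff_range hq).1 hqM
  rw [baseProj_graphMap]

/-- Graph charts from the implicit function theorem. -/
theorem exists_isGraphChart {U₀ : Set (Space k)} {g : Space k → ℝ}
    (hg : IsLocalDefiningFunction M U₀ g) {p : Space k} (hp : p ∈ U₀) (hpM : p ∈ M)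
    (R : WithLp 2 (V × ℝ) ≃ₗᵢ[ℝ] Space k)
    (hR : ⟪∇ g p, R (WithLp.toLp 2 (0, 1))⟫_ℝ ≠ 0) :
    ∃ (U : Set (Space k)) (u : V → ℝ), p ∈ U ∧ IsGraphChart M U R u := by
  set T : (V × ℝ) ≃L[ℝ] Space k :=
    (WithLp.prodContinuousLinearEquiv 2 ℝ V ℝ).symm.trans R.toContinuousLinearEquiv with hT
  have hTapp : ∀ x : V × ℝ, T x = R (WithLp.toLp 2 x) := fun x => rfl
  set w : Space k := R (WithLp.toLp 2 (0, 1)) with hw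
  have hgd : ∀ q ∈ U₀, ContDiffAt ℝ ∞ g q := fun q hq =>
    hg.contDiffOn.contDiffAt (hg.isOpen.mem_nhds hq)
  have hgc : ContinuousOn (fun q => fderiv ℝ g q w) U₀ := by
    have := (hg.contDiffOn.continuousOn_fderiv_of_isOpen hg.isOpen (by simp))
    exact this.clm_apply continuousOn_const
  -- On all of `Ω` the derivative of `G` below is invertible, which makes the local inverse smooth
  -- on an open set and not only at the image of the base point.
  set Ω : Set (Space k) := U₀ ∩ (fun q => fderiv ℝ g q w) ⁻¹' {0}ᶜ with hΩ
  have hΩo : IsOpen Ω := hgc.isOpen_inter_preimage hg.isOpen isOpen_compl_singleton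
  have hpΩ : p ∈ Ω := by
    refine ⟨hp, ?_⟩
    simpa [gradient] using hR
  set G : V × ℝ → V × ℝ := fun x => (x.1, g (T x)) with hG
  have hGs : ∀ x, T x ∈ U₀ → ContDiffAt ℝ ∞ G x := fun x hx =>
    contDiffAt_fst.prodMk ((hgd _ hx).comp x T.contDiff.contDiffAt)
  have hGd : ∀ x, T x ∈ Ω → ∃ L : (V × ℝ) ≃L[ℝ] (V × ℝ),
      HasFDerivAt G (L : (V × ℝ) →L[ℝ] (V × ℝ)) x := by
    intro x hx
    set L : (V × ℝ) →L[ℝ] (V × ℝ) := (ContinuousLinearMap.fst ℝ V ℝ).prod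
      (fderiv ℝ g (T x) ∘L T.toContinuousLinearMap) with hL
    have hinj : Function.Injective L.toLinearMap := by
      rw [← LinearMap.ker_eq_bot, LinearMap.ker_eq_bot']
      rintro ⟨v, s⟩ hvs
      have h1 : v = 0 := congrArg Prod.fst hvs
      have h2 : fderiv ℝ g (T x) (T (v, s)) = 0 := congrArg Prod.snd hvs
      subst h1
      have h3 : T ((0 : V), s) = s • w := by
        rw [hw, ← hTapp, ← map_smul]; simp
      rw [h3, map_smul, smul_eq_mul] at h2
      rcases mul_eq_zero.1 h2 with h | h
      · simp [h]
      · exact absurd h hx.2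
    refine ⟨(LinearEquiv.ofInjectiveEndo L.toLinearMap hinj).toContinuousLinearEquiv, ?_⟩
    have h1 : HasFDerivAt G L x := hasFDerivAt_fst.prodMk
      (((hgd _ hx.1).differentiableAt (by simp)).hasFDerivAt.comp x T.hasFDerivAt)
    exact h1.congr_fderiv (ContinuousLinearMap.ext fun v => rfl)
  set x₀ : V × ℝ := T.symm p with hx₀
  have hTx₀ : T x₀ = p := T.apply_symm_apply p
  obtain ⟨L₀, hL₀⟩ := hGd x₀ (by rwa [hTx₀])
  have hst : HasStrictFDerivAt G (L₀ : (V × ℝ) →L[ℝ] (V × ℝ)) x₀ :=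
    (hGs x₀ (by rwa [hTx₀])).hasStrictFDerivAt' hL₀ (by simp)
  set Φ := hst.toOpenPartialHomeomorph G with hΦ
  have hΦc : ∀ x, Φ x = G x := fun x => rfl
  have hx₀s : x₀ ∈ Φ.source := hst.mem_toOpenPartialHomeomorph_source
  have hgp : g p = 0 := by
    have : p ∈ M ∩ U₀ := ⟨hpM, hp⟩
    rw [hg.inter_eq] at this
    exact this.2
  have hGx₀ : G x₀ = (x₀.1, 0) := by simp [hG, hTx₀, hgp]
  set O : Set V := (fun x : V => (x, (0 : ℝ))) ⁻¹' (Φ.target ∩ Φ.symm ⁻¹' (T ⁻¹' Ω)) with hO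
  have hOo : IsOpen O := (Φ.isOpen_inter_preimage_symm (hΩo.preimage T.continuous)).preimage
    (by fun_prop)
  have hxO : x₀.1 ∈ O := by
    have h1 : Φ x₀ = (x₀.1, 0) := hGx₀
    change (x₀.1, (0 : ℝ)) ∈ Φ.target ∩ Φ.symm ⁻¹' (T ⁻¹' Ω)
    rw [← h1]
    refine ⟨Φ.map_source hx₀s, ?_⟩
    change T (Φ.symm (Φ x₀)) ∈ Ω
    rw [Φ.left_inv hx₀s, hTx₀]
    exact hpΩ
  set ψ : V → ℝ := fun x => (Φ.symm (x, 0)).2 with hψ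
  have hψs : ∀ x ∈ O, ContDiffAt ℝ ∞ ψ x := by
    intro x hx
    obtain ⟨L, hL⟩ := hGd _ hx.2
    have h1 := Φ.contDiffAt_symm (n := ∞) hx.1 hL (hGs _ hx.2.1)
    exact contDiffAt_snd.comp x (ContDiffAt.comp x (g := Φ.symm) h1
      (contDiffAt_id.prodMk contDiffAt_const))
  obtain ⟨r, hr, hrO⟩ := Metric.isOpen_iff.1 hOo _ hxO
  -- The implicit function is smooth only on `O`. Multiplication by a bump function extends it to
  -- the whole base without changing it over the ball of radius `r / 4`, where the chart is used.
  let χ : ContDiffBump x₀.1 := ⟨r / 4, r / 2, by positivity, by linarith⟩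
  refine ⟨Ω ∩ {q | T.symm q ∈ Φ.source ∧ (T.symm q).1 ∈ Metric.ball x₀.1 (r / 4)},
    fun x => χ x * ψ x, ⟨hpΩ, hx₀s, Metric.mem_ball_self (by positivity)⟩, ?_, ?_, ?_⟩
  · refine hΩo.inter ((Φ.open_source.preimage T.symm.continuous).inter
      (Metric.isOpen_ball.preimage (continuous_fst.comp T.symm.continuous)))
  · rw [contDiff_iff_contDiffAt]
    intro x
    by_cases hx : x ∈ O
    · exact χ.contDiff.contDiffAt.mul (hψs x hx)
    · have hx' : x ∉ tsupport χ := by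
        rw [χ.tsupport_eq]
        intro h
        refine hx (hrO (Metric.closedBall_subset_ball ?_ h))
        change r / 2 < r
        linarith
      refine (contDiffAt_const (c := (0 : ℝ))).congr_of_eventuallyEq ?_
      filter_upwards [(isClosed_tsupport χ).isOpen_compl.mem_nhds hx'] with y hy
      rw [image_eq_zero_of_notMem_tsupport hy, zero_mul]
  · rintro q ⟨hqΩ, hqs, hqb⟩
    set x := T.symm q with hx
    have hTq : T x = q := T.apply_symm_apply q
    have hxO : x.1 ∈ O := hrO (Metric.ball_subset_ball (by linarith) hqb)
    have hχ : χ x.1 = 1 := χ.one_of_mem_closedBall (Metric.ball_subset_closedBall hqb)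
    have h1 : q ∈ M ↔ g q = 0 := by
      have : q ∈ M ∩ U₀ ↔ q ∈ {y ∈ U₀ | g y = 0} := by rw [hg.inter_eq]
      simpa [hqΩ.1] using this
    rw [h1]
    change g q = 0 ↔ x.2 = χ x.1 * ψ x.1
    rw [hχ, one_mul]
    constructor
    · intro h
      have h2 : Φ x = (x.1, 0) := by rw [hΦc, hG]; simp [hTq, h]
      rw [hψ]
      simp only
      rw [← h2, Φ.left_inv hqs]
    · intro h
      have h2 : G (Φ.symm (x.1, 0)) = (x.1, 0) := Φ.right_inv hxO.1
      have h3 : (G (Φ.symm (x.1, 0))).1 = x.1 := by rw [h2]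
      have h4 : Φ.symm (x.1, 0) = x := Prod.ext h3 h.symm
      rw [h4] at h2
      have h5 : (G x).2 = 0 := by rw [h2]
      change g (T x) = 0 at h5
      rwa [hTq] at h5

-- Tangent cones are local, so `M` may be replaced by the graph, whose cone is already a linear
-- subspace.
omit [FiniteDimensional ℝ V] in
theorem IsGraphChart.tangentSpace_eq (h : IsGraphChart M U R u) {x : V}
    (hx : graphMap R u x ∈ U) :
    tangentSpace M (graphMap R u x) = (ℝ ∙ graphNormal R u x)ᗮ := by
  have hd : DifferentiableAt ℝ u x := h.contDiff.differentiable (by simp) x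
  have h1 : tangentConeAt ℝ M (graphMap R u x) =
      tangentConeAt ℝ (range (graphMap R u)) (graphMap R u x) := by
    refine tangentConeAt_congr ?_
    refine nhdsWithin_eq_nhdsWithin hx h.isOpen ?_
    ext q
    exact and_congr_left fun hq => h.mem_iff_range hq
  have h2 : ((ℝ ∙ graphNormal R u x)ᗮ : Set (Space k)) =
      {v | ⟪graphNormal R u x, v⟫_ℝ = 0} := by
    ext v
    exact Submodule.mem_orthogonal_singleton_iff_inner_right
  rw [tangentSpace, h1, tangentConeAt_range_graphMap R hd, ← h2, Submodule.span_eq]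

omit [FiniteDimensional ℝ V] in
theorem IsGraphChart.starProjection_eq (h : IsGraphChart M U R u) {x : V}
    (hx : graphMap R u x ∈ U) (e : Space k) :
    (tangentSpace M (graphMap R u x)).starProjection e =
      e - (⟪graphNormal R u x, e⟫_ℝ / areaElement u x ^ 2) • graphNormal R u x := by
  have : (tangentSpace M (graphMap R u x)).starProjection e =
      ((ℝ ∙ graphNormal R u x)ᗮ).starProjection e := by
    congr 1
    congr 1
    exact h.tangentSpace_eq hx
  rw [this, Submodule.starProjection_orthogonal_val, Submodule.starProjection_singleton,
    norm_graphNormal]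
  rfl

omit [FiniteDimensional ℝ V] in
/-- The tangential part of a constant vector field, read in a graph chart. -/
theorem IsGraphChart.areaElement_smul_starProjection (h : IsGraphChart M U R u) {x : V}
    (hx : graphMap R u x ∈ U) (e : Space k) :
    areaElement u x • (tangentSpace M (graphMap R u x)).starProjection e =
      fderiv ℝ (graphMap R u) x (flux u (R.symm e) x) := by
  have hd : DifferentiableAt ℝ u x := h.contDiff.differentiable (by simp) x
  rw [h.starProjection_eq hx, fderiv_graphMap_apply R hd, ← inner_gradient_eq]
  have hW := areaElement_pos u x
  have hW2 := areaElement_sq u x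
  apply R.symm.injective
  rw [R.symm_apply_apply, map_smul, map_sub, map_smul, inner_graphNormal, graphNormal,
    R.symm_apply_apply]
  set a := R.symm e
  have hG : ⟪∇ u x, ∇ u x⟫_ℝ = areaElement u x ^ 2 - 1 := by
    rw [hW2, real_inner_self_eq_norm_sq]; ring
  refine WithLp.ofLp_injective 2 (Prod.ext ?_ ?_)
  · change areaElement u x • (a.fst - ((a.snd - ⟪∇ u x, a.fst⟫_ℝ) / areaElement u x ^ 2) •
      (-∇ u x)) = flux u a x
    rw [flux, normalPart, smul_sub, smul_neg, smul_neg, sub_neg_eq_add, smul_smul, smul_smul]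
    congr 2
    field_simp
  · change areaElement u x * (a.snd - ((a.snd - ⟪∇ u x, a.fst⟫_ℝ) / areaElement u x ^ 2) * 1) =
      ⟪∇ u x, flux u a x⟫_ℝ
    rw [flux, normalPart, inner_add_right, real_inner_smul_right, real_inner_smul_right,
      real_inner_smul_right, hG]
    field_simp
    ring

/-- Minimality is assumed for every local defining function, in particular for the one attached to
the graph; its mean curvature is `-div (normalPart u)`. -/
theorem IsGraphChart.divergence_flux (h : IsGraphChart M U R u) (hmin : IsMinimal M) {x : V}
    (hx : graphMap R u x ∈ U) (a : WithLp 2 (V × ℝ)) : divergence (flux u a) x = 0 := by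
  have hd : Differentiable ℝ u := h.contDiff.differentiable (by simp)
  refine divergence_flux_eq_zero h.contDiff a ?_
  have hgr : ∀ y, ∇ (graphDefiningFunction R u) y = graphNormal R u (baseProj R y) := fun y =>
    (hasGradientAt_graphDefiningFunction R (hd _)).gradient
  have hdef : IsLocalDefiningFunction M U (graphDefiningFunction R u) := by
    refine ⟨h.isOpen, ?_, fun y _ h0 => ?_, ?_⟩
    · refine ContDiff.contDiffOn ?_
      exact ((WithLp.sndL 2 ℝ V ℝ).contDiff.comp R.symm.contDiff).sub
        (h.contDiff.comp (baseProj R).contDiff)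
    · rw [hgr] at h0
      have h1 := norm_graphNormal R (u := u) (baseProj R y)
      rw [h0, norm_zero] at h1
      exact (areaElement_pos u _).ne h1
    · ext q
      simp only [mem_inter_iff, mem_ofPred_eq, graphDefiningFunction, sub_eq_zero]
      constructor
      · rintro ⟨h1, h2⟩
        exact ⟨h2, (h.mem_iff q h2).1 h1⟩
      · rintro ⟨h1, h2⟩
        exact ⟨(h.mem_iff q h1).2 h2, h1⟩
  have h0 := hmin U _ hdef (graphMap R u x) ⟨h.graphMap_mem hx, hx⟩
  have h1 := divergence_normalPart R h.contDiff (graphMap R u x)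
  rw [baseProj_graphMap] at h1
  rw [h1, neg_eq_zero]
  exact h0

end Charts

/-! ### Hausdorff integrals over parametrized sets. -/

section AreaIntegrals

variable {V E : Type*} [NormedAddCommGroup V] [InnerProductSpace ℝ V] [FiniteDimensional ℝ V]
  [MeasurableSpace V] [BorelSpace V] [NormedAddCommGroup E] [InnerProductSpace ℝ E]
  [MeasurableSpace E] [BorelSpace E]

theorem map_withDensity_ofReal_eq_restrict_range {f : V → E} {W : V → ℝ}
    (hf : MeasurableEmbedding f) (hf' : ContDiff ℝ 1 f) (hW : Continuous W) (hpos : ∀ x, 0 < W x)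
    (hdet : ∀ x, (fderiv ℝ f x).toLinearMap.normDet = W x) :
    Measure.map f (volume.withDensity fun x => ((W x).toNNReal : ENNReal)) =
      (μHE[Module.finrank ℝ V] : Measure E).restrict (range f) :=
  map_withDensity_eq_restrict_range hf
    (fun x => (hf'.contDiffAt.hasStrictFDerivAt one_ne_zero)) (by fun_prop)
    (fun x => Real.toNNReal_pos.2 (hpos x)) fun x => by
      rw [hdet, Real.coe_toNNReal _ (hpos x).le]

theorem setIntegral_range_eq {f : V → E} {W : V → ℝ}
    (hf : MeasurableEmbedding f) (hf' : ContDiff ℝ 1 f) (hW : Continuous W) (hpos : ∀ x, 0 < W x)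
    (hdet : ∀ x, (fderiv ℝ f x).toLinearMap.normDet = W x) (h : E → ℝ) :
    ∫ q in range f, h q ∂μHE[Module.finrank ℝ V] = ∫ x, W x * h (f x) := by
  rw [← map_withDensity_ofReal_eq_restrict_range hf hf' hW hpos hdet, hf.integral_map,
    integral_withDensity_eq_integral_smul (by fun_prop)]
  simp [NNReal.smul_def, (hpos _).le]

theorem integrableOn_range_iff {f : V → E} {W : V → ℝ}
    (hf : MeasurableEmbedding f) (hf' : ContDiff ℝ 1 f) (hW : Continuous W) (hpos : ∀ x, 0 < W x)
    (hdet : ∀ x, (fderiv ℝ f x).toLinearMap.normDet = W x) (h : E → ℝ) :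
    IntegrableOn h (range f) μHE[Module.finrank ℝ V] ↔ Integrable fun x => W x * h (f x) := by
  rw [IntegrableOn, ← map_withDensity_ofReal_eq_restrict_range hf hf' hW hpos hdet,
    hf.integrable_map_iff, integrable_withDensity_iff_integrable_smul (by fun_prop)]
  simp [NNReal.smul_def, (hpos _).le]

omit [MeasurableSpace V] [BorelSpace V] [MeasurableSpace E] [BorelSpace E] in
theorem normDet_fderiv_graphMap [FiniteDimensional ℝ E] [CompleteSpace V]
    (R : WithLp 2 (V × ℝ) ≃ₗᵢ[ℝ] E) {u : V → ℝ} {x : V} (hu : DifferentiableAt ℝ u x) :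
    (fderiv ℝ (graphMap R u) x).toLinearMap.normDet = areaElement u x := by
  refine normDet_of_norm_sq fun v w => ?_
  rw [fderiv_graphMap_apply R hu, fderiv_graphMap_apply R hu, R.inner_map_map,
    WithLp.prod_inner_apply, inner_gradient_eq, inner_gradient_eq]
  simp [mul_comm]

end AreaIntegrals

/-! ### Horizontal slices of a graph and their conormal. -/

section LevelSets

variable {k : ℕ}

/-- The model of the tangent hyperplanes: `ℝ^k` and the direction of the axis. -/
abbrev Base (k : ℕ) : Type := WithLp 2 (EuclideanSpace ℝ (Fin k) × ℝ)

/-- The unit vector of the last coordinate of the base. -/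
noncomputable def baseAxis (k : ℕ) : Base k := WithLp.toLp 2 (0, 1)

/-- The area element of the slices of a graph over the base. -/
noncomputable def sliceAreaElement (u : Base k → ℝ) (x : Base k) : ℝ :=
  √(1 + ‖(∇ u x).fst‖ ^ 2)

/-- The parametrization of the part of a graph that lies over a level of the last coordinate of
the base. -/
noncomputable def sliceMap (R : WithLp 2 (Base k × ℝ) ≃ₗᵢ[ℝ] Space k) (u : Base k → ℝ) (t : ℝ)
    (z : EuclideanSpace ℝ (Fin k)) : Space k := graphMap R u (WithLp.toLp 2 (z, t))

/-- The last coordinate of the base corresponds to the height in the ambient space. -/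
def IsVertical (R : WithLp 2 (Base k × ℝ) ≃ₗᵢ[ℝ] Space k) : Prop :=
  R (WithLp.toLp 2 (baseAxis k, 0)) = axis k

variable {R : WithLp 2 (Base k × ℝ) ≃ₗᵢ[ℝ] Space k} {u : Base k → ℝ} {M U : Set (Space k)}

theorem inner_axis (q : Space k) : ⟪axis k, q⟫_ℝ = height q := by
  simp [axis, height, EuclideanSpace.inner_single_left]

theorem continuous_height : Continuous (height : Space k → ℝ) := by
  unfold height; fun_prop

theorem inner_baseAxis (x : Base k) : ⟪baseAxis k, x⟫_ℝ = x.snd := by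
  simp [baseAxis, WithLp.prod_inner_apply]

theorem IsVertical.height_eq (hR : IsVertical R) (q : Space k) :
    height q = (baseProj R q).snd := by
  obtain ⟨y, rfl⟩ := R.surjective q
  rw [← inner_axis, ← hR, R.inner_map_map, WithLp.prod_inner_apply, baseProj_apply,
    R.symm_apply_apply]
  change ⟪baseAxis k, y.fst⟫_ℝ + ⟪(0 : ℝ), y.snd⟫_ℝ = y.fst.snd
  rw [inner_zero_left, add_zero, inner_baseAxis]

theorem IsVertical.height_graphMap (hR : IsVertical R) (x : Base k) :
    height (graphMap R u x) = x.snd := by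
  rw [hR.height_eq, baseProj_graphMap]

theorem IsVertical.mem_range_sliceMap (hR : IsVertical R) (h : IsGraphChart M U R u) {t : ℝ}
    {q : Space k} (hq : q ∈ U) : q ∈ range (sliceMap R u t) ↔ q ∈ crossSection M t := by
  constructor
  · rintro ⟨z, rfl⟩
    exact ⟨h.graphMap_mem hq, hR.height_graphMap _⟩
  · rintro ⟨hM, ht⟩
    refine ⟨(baseProj R q).fst, ?_⟩
    rw [sliceMap, ← ht, hR.height_eq]
    exact h.graphMap_baseProj hq hM

theorem isClosedEmbedding_sliceMap (hu : Continuous u) (t : ℝ) :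
    IsClosedEmbedding (sliceMap R u t) :=
  (isClosedEmbedding_graphMap R hu).comp (isClosedEmbedding_toLp_left t)

theorem contDiff_sliceMap {n : WithTop ℕ∞} (hu : ContDiff ℝ n u) (t : ℝ) :
    ContDiff ℝ n (sliceMap R u t) :=
  (contDiff_graphMap R hu).comp
    ((WithLp.prodContinuousLinearEquiv 2 ℝ (EuclideanSpace ℝ (Fin k)) ℝ).symm.contDiff.comp
      (contDiff_id.prodMk contDiff_const))

theorem fderiv_sliceMap_apply {t : ℝ} {z : EuclideanSpace ℝ (Fin k)}
    (hu : DifferentiableAt ℝ u (WithLp.toLp 2 (z, t))) (v : EuclideanSpace ℝ (Fin k)) :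
    fderiv ℝ (sliceMap R u t) z v =
      fderiv ℝ (graphMap R u) (WithLp.toLp 2 (z, t)) (WithLp.toLp 2 (v, 0)) := by
  have h1 : HasFDerivAt (fun z : EuclideanSpace ℝ (Fin k) => (WithLp.toLp 2 (z, t) : Base k))
      (inlL _) z := by
    have := ((inlL (EuclideanSpace ℝ (Fin k))).hasFDerivAt (x := z)).add_const (inrL _ t)
    refine this.congr_of_eventuallyEq (Eventually.of_forall fun y => ?_)
    exact (inlL_add_inrL y t).symm
  have h2 : HasFDerivAt (sliceMap R u t) _ z :=
    ((hasFDerivAt_graphMap R hu).differentiableAt.hasFDerivAt).comp z h1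
  rw [h2.fderiv]
  rfl

theorem normDet_fderiv_sliceMap {t : ℝ} {z : EuclideanSpace ℝ (Fin k)}
    (hu : DifferentiableAt ℝ u (WithLp.toLp 2 (z, t))) :
    (fderiv ℝ (sliceMap R u t) z).toLinearMap.normDet =
      sliceAreaElement u (WithLp.toLp 2 (z, t)) := by
  refine normDet_of_norm_sq fun v w => ?_
  rw [fderiv_sliceMap_apply hu, fderiv_sliceMap_apply hu, fderiv_graphMap_apply R hu,
    fderiv_graphMap_apply R hu, R.inner_map_map, ← inner_gradient_eq, ← inner_gradient_eq]
  simp only [WithLp.prod_inner_apply]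
  simp [mul_comm]

theorem sliceAreaElement_pos (u : Base k → ℝ) (x : Base k) : 0 < sliceAreaElement u x := by
  unfold sliceAreaElement; positivity

theorem continuous_sliceAreaElement (hu : ContDiff ℝ ∞ u) : Continuous (sliceAreaElement u) := by
  have := (WithLp.continuous_fst 2 (EuclideanSpace ℝ (Fin k)) ℝ).comp
    (contDiff_gradient hu).continuous
  exact (continuous_const.add (this.norm.pow 2)).sqrt

theorem continuous_toLp_left (t : ℝ) :
    Continuous fun z : EuclideanSpace ℝ (Fin k) => (WithLp.toLp 2 (z, t) : Base k) :=
  (isClosedEmbedding_toLp_left t).continuous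

/-- The flux density of a constant vector field through the slices of a graph. -/
theorem IsGraphChart.sliceAreaElement_mul_inner_conormal (h : IsGraphChart M U R u)
    (hR : IsVertical R) {x : Base k} (hx : graphMap R u x ∈ U) (e : Space k) :
    sliceAreaElement u x * ⟪e, conormal M (graphMap R u x)⟫_ℝ = (flux u (R.symm e) x).snd := by
  set P := (tangentSpace M (graphMap R u x)).starProjection with hP
  have hd : DifferentiableAt ℝ u x := h.contDiff.differentiable (by simp) x
  have hW := areaElement_pos u x
  have hS := sliceAreaElement_pos u x
  -- Self-adjointness of the projection moves it from `e_n` to `e`; pairing with `e_n` then reads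
  -- off the height component of the flux.
  have h1 : ∀ e, areaElement u x * ⟪e, P (axis k)⟫_ℝ = (flux u (R.symm e) x).snd := by
    intro e
    rw [hP, ← Submodule.inner_starProjection_left_eq_right, ← real_inner_smul_left,
      h.areaElement_smul_starProjection hx, fderiv_graphMap_apply R hd, ← hR, R.inner_map_map,
      WithLp.prod_inner_apply]
    change ⟪_, baseAxis k⟫_ℝ + ⟪_, (0 : ℝ)⟫_ℝ = _
    rw [inner_zero_right, add_zero, real_inner_comm, inner_baseAxis]
  -- The coarea factor `|e_n^⊤|` is the ratio of the area elements of slice and graph. It is found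
  -- by taking `e = e_n` in `h1`.
  have h2 : areaElement u x * ‖P (axis k)‖ = sliceAreaElement u x := by
    have h3 : ⟪axis k, P (axis k)⟫_ℝ = ‖P (axis k)‖ ^ 2 := by
      have := (tangentSpace M (graphMap R u x)).re_inner_starProjection_eq_normSq (axis k)
      rw [real_inner_comm]
      simpa using this
    have h4 := areaElement_sq u x
    rw [WithLp.prod_norm_sq_eq_of_L2, Real.norm_eq_abs, sq_abs] at h4
    have h5 := h1 (axis k)
    rw [h3, ← hR, R.symm_apply_apply] at h5
    replace h5 : areaElement u x * ‖P (axis k)‖ ^ 2 = areaElement u x * 1 +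
        (0 - ⟪∇ u x, baseAxis k⟫_ℝ) * ((areaElement u x)⁻¹ * (∇ u x).snd) := by
      rw [hR] at h5; exact h5
    rw [real_inner_comm, inner_baseAxis] at h5
    rw [sliceAreaElement, eq_comm, Real.sqrt_eq_iff_eq_sq (by positivity) (by positivity)]
    field_simp at h5
    nlinarith
  have h3 : ‖P (axis k)‖ = sliceAreaElement u x / areaElement u x := by
    rw [← h2]; field_simp
  rw [conormal, real_inner_smul_right, ← h1 e, ← hP, h3]
  field_simp

end LevelSets

/-! ### The divergence theorem in a chart, with a test function. -/

section LocalFormulas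

variable {k : ℕ} {R : WithLp 2 (Base k × ℝ) ≃ₗᵢ[ℝ] Space k} {u : Base k → ℝ}
  {M U D S : Set (Space k)} {φ : Space k → ℝ} {t : ℝ}

/-- The flux of a constant vector field, localized with a test function. -/
noncomputable def testField (R : WithLp 2 (Base k × ℝ) ≃ₗᵢ[ℝ] Space k) (u : Base k → ℝ)
    (φ : Space k → ℝ) (e : Space k) (x : Base k) : Base k :=
  φ (graphMap R u x) • flux u (R.symm e) x

theorem contDiff_testField (hu : ContDiff ℝ ∞ u) (hφ : ContDiff ℝ ∞ φ) (e : Space k) :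
    ContDiff ℝ 1 (testField R u φ e) :=
  ((hφ.comp (contDiff_graphMap R hu)).smul (contDiff_flux hu _)).of_le (by simp)

theorem hasCompactSupport_testField (hu : ContDiff ℝ ∞ u) (hφ : HasCompactSupport φ)
    (e : Space k) : HasCompactSupport (testField R u φ e) :=
  (hφ.comp_isClosedEmbedding (isClosedEmbedding_graphMap R hu.continuous)).smul_right

/-- As `G` vanishes off `U`, only the part of `S` in the chart counts, and `S` may be exchanged for
the whole slice of the globally defined graph, to which the area formula applies. -/
theorem IsGraphChart.indicator_slice_eq (h : IsGraphChart M U R u) (hR : IsVertical R)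
    (hS : ∀ q ∈ U, q ∈ S ↔ q ∈ crossSection M t) {G : Space k → ℝ} (hG : ∀ q ∉ U, G q = 0) :
    S.indicator G = (range (sliceMap R u t)).indicator G := by
  ext q
  by_cases hq : q ∈ U
  · have : q ∈ S ↔ q ∈ range (sliceMap R u t) := by
      rw [hS q hq, hR.mem_range_sliceMap h hq]
    by_cases hs : q ∈ S
    · rw [indicator_of_mem hs, indicator_of_mem (this.1 hs)]
    · rw [indicator_of_notMem hs, indicator_of_notMem (mt this.2 hs)]
  · simp [indicator, hG q hq]

theorem IsGraphChart.slice_density (h : IsGraphChart M U R u) (hR : IsVertical R)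
    (hφ : tsupport φ ⊆ U) (e : Space k) (x : Base k) :
    sliceAreaElement u x * (φ (graphMap R u x) * ⟪e, conormal M (graphMap R u x)⟫_ℝ) =
      (testField R u φ e x).snd := by
  by_cases hq : graphMap R u x ∈ U
  · rw [mul_left_comm, h.sliceAreaElement_mul_inner_conormal hR hq]
    rfl
  · have : φ (graphMap R u x) = 0 := image_eq_zero_of_notMem_tsupport fun h' => hq (hφ h')
    simp [testField, this]

theorem IsGraphChart.integrableOn_slice (h : IsGraphChart M U R u) (hR : IsVertical R)
    (hSm : MeasurableSet S) (hS : ∀ q ∈ U, q ∈ S ↔ q ∈ crossSection M t)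
    (hφ : ContDiff ℝ ∞ φ) (hφc : HasCompactSupport φ) (hφU : tsupport φ ⊆ U) (e : Space k) :
    IntegrableOn (fun q => φ q * ⟪e, conormal M q⟫_ℝ) S μHE[k] := by
  have hcl := isClosedEmbedding_sliceMap (R := R) h.contDiff.continuous t
  have hd : Differentiable ℝ u := h.contDiff.differentiable (by simp)
  have h0 : ∀ q ∉ U, φ q * ⟪e, conormal M q⟫_ℝ = 0 := fun q hq => by
    rw [image_eq_zero_of_notMem_tsupport fun h' => hq (hφU h'), zero_mul]
  rw [← integrable_indicator_iff hSm, h.indicator_slice_eq hR hS h0,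
    integrable_indicator_iff hcl.isClosed_range.measurableSet]
  have key := integrableOn_range_iff hcl.measurableEmbedding
    ((contDiff_sliceMap (R := R) h.contDiff t).of_le (by simp))
    ((continuous_sliceAreaElement h.contDiff).comp (continuous_toLp_left t))
    (fun z => sliceAreaElement_pos u _) (fun z => normDet_fderiv_sliceMap (hd _))
    (fun q => φ q * ⟪e, conormal M q⟫_ℝ)
  rw [finrank_euclideanSpace_fin] at key
  rw [key]
  have heq : (fun z : EuclideanSpace ℝ (Fin k) =>
      (sliceAreaElement u ∘ fun z => WithLp.toLp 2 (z, t)) z *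
        (φ (sliceMap R u t z) * ⟪e, conormal M (sliceMap R u t z)⟫_ℝ)) =
      fun z => (testField R u φ e (WithLp.toLp 2 (z, t))).snd :=
    funext fun z => h.slice_density hR hφU e _
  rw [heq]
  refine Continuous.integrable_of_hasCompactSupport ?_ ?_
  · exact (WithLp.continuous_snd 2 _ ℝ).comp
      ((contDiff_testField h.contDiff hφ e).continuous.comp (continuous_toLp_left t))
  · exact ((hasCompactSupport_testField h.contDiff hφc e).comp_isClosedEmbedding
      (isClosedEmbedding_toLp_left t)).comp_left (g := WithLp.snd) rfl

theorem IsGraphChart.setIntegral_slice (h : IsGraphChart M U R u) (hR : IsVertical R)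
    (hSm : MeasurableSet S) (hS : ∀ q ∈ U, q ∈ S ↔ q ∈ crossSection M t)
    (hφU : tsupport φ ⊆ U) (e : Space k) :
    ∫ q in S, φ q * ⟪e, conormal M q⟫_ℝ ∂μHE[k] =
      ∫ z, (testField R u φ e (WithLp.toLp 2 (z, t))).snd := by
  have hcl := isClosedEmbedding_sliceMap (R := R) h.contDiff.continuous t
  have hd : Differentiable ℝ u := h.contDiff.differentiable (by simp)
  have h0 : ∀ q ∉ U, φ q * ⟪e, conormal M q⟫_ℝ = 0 := fun q hq => by
    rw [image_eq_zero_of_notMem_tsupport fun h' => hq (hφU h'), zero_mul]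
  rw [← integral_indicator hSm, h.indicator_slice_eq hR hS h0,
    integral_indicator hcl.isClosed_range.measurableSet]
  have key := setIntegral_range_eq hcl.measurableEmbedding
    ((contDiff_sliceMap (R := R) h.contDiff t).of_le (by simp))
    ((continuous_sliceAreaElement h.contDiff).comp (continuous_toLp_left t))
    (fun z => sliceAreaElement_pos u _) (fun z => normDet_fderiv_sliceMap (hd _))
    (fun q => φ q * ⟪e, conormal M q⟫_ℝ)
  rw [finrank_euclideanSpace_fin] at key
  rw [key]
  exact integral_congr_ae (Eventually.of_forall fun z => h.slice_density hR hφU e _)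

/-- The derivative of `φ` in the direction of the tangential part of `e`. -/
noncomputable def tangentialDeriv (M : Set (Space k)) (φ : Space k → ℝ) (e q : Space k) : ℝ :=
  fderiv ℝ φ q ((tangentSpace M q).starProjection e)

theorem tangentialDeriv_eq_zero {q : Space k} (hq : q ∉ tsupport φ) (e : Space k) :
    tangentialDeriv M φ e q = 0 := by
  have : fderiv ℝ φ q = 0 := by
    by_contra h
    exact hq (support_fderiv_subset ℝ h)
  rw [tangentialDeriv, this, zero_apply]

/-- In the product rule for `φ · flux` the divergence of the flux drops out inside the chart; what
remains is `dφ` applied to the image `W e^⊤` of the flux. Outside the chart both sides vanish. -/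
theorem IsGraphChart.bulk_density (h : IsGraphChart M U R u) (hmin : IsMinimal M)
    (hφ : ContDiff ℝ ∞ φ) (hφU : tsupport φ ⊆ U) (e : Space k) (x : Base k) :
    areaElement u x * tangentialDeriv M φ e (graphMap R u x) =
      divergence (testField R u φ e) x := by
  have hd : Differentiable ℝ u := h.contDiff.differentiable (by simp)
  have hfd := (hasFDerivAt_graphMap R (hd x)).differentiableAt.hasFDerivAt
  have hφd := (hφ.differentiable (by simp) (graphMap R u x)).hasFDerivAt
  have h1 : divergence (testField R u φ e) x = φ (graphMap R u x) *
      divergence (flux u (R.symm e)) x + fderiv ℝ (φ ∘ graphMap R u) x (flux u (R.symm e) x) :=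
    divergence_smul (ψ := φ ∘ graphMap R u) (hφd.comp x hfd).differentiableAt
      ((contDiff_flux h.contDiff (R.symm e)).differentiable (by simp) x)
  rw [h1, fderiv_comp x hφd.differentiableAt hfd.differentiableAt]
  by_cases hq : graphMap R u x ∈ U
  · rw [h.divergence_flux hmin hq, mul_zero, zero_add, ContinuousLinearMap.comp_apply,
      ← h.areaElement_smul_starProjection hq, map_smul]
    rfl
  · have hq' : graphMap R u x ∉ tsupport φ := fun h' => hq (hφU h')
    have h3 : fderiv ℝ φ (graphMap R u x) = 0 := by
      by_contra h
      exact hq' (support_fderiv_subset ℝ h)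
    rw [tangentialDeriv_eq_zero hq', image_eq_zero_of_notMem_tsupport hq', h3]
    simp

theorem finrank_base : Module.finrank ℝ (Base k) = k + 1 := by
  have h1 := (WithLp.prodContinuousLinearEquiv 2 ℝ (EuclideanSpace ℝ (Fin k))
    ℝ).toLinearEquiv.finrank_eq
  rw [h1]
  simp

theorem IsGraphChart.indicator_bulk_eq (h : IsGraphChart M U R u) (hDM : D ⊆ M)
    {G : Space k → ℝ} (hG : ∀ q ∉ U, G q = 0) :
    D.indicator G = (range (graphMap R u)).indicator (D.indicator G) := by
  ext q
  by_cases hq : q ∈ range (graphMap R u)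
  · rw [indicator_of_mem hq]
  · rw [indicator_of_notMem hq]
    by_cases hU : q ∈ U
    · refine indicator_of_notMem (fun hD => hq ?_) _
      exact (h.mem_iff_range hU).1 (hDM hD)
    · simp [indicator, hG q hU]

theorem IsGraphChart.bulk_indicator_density (h : IsGraphChart M U R u) (hmin : IsMinimal M)
    (hφ : ContDiff ℝ ∞ φ) (hφU : tsupport φ ⊆ U) (e : Space k) :
    (fun x => areaElement u x * D.indicator (tangentialDeriv M φ e) (graphMap R u x)) =
      (graphMap R u ⁻¹' D).indicator (divergence (testField R u φ e)) := by
  ext x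
  by_cases hx : graphMap R u x ∈ D
  · rw [indicator_of_mem hx, indicator_of_mem (by exact hx), h.bulk_density hmin hφ hφU]
  · rw [indicator_of_notMem hx, indicator_of_notMem (by exact hx), mul_zero]

theorem IsGraphChart.integrableOn_bulk (h : IsGraphChart M U R u) (hmin : IsMinimal M)
    (hDM : D ⊆ M) (hD : MeasurableSet D) (hφ : ContDiff ℝ ∞ φ) (hφc : HasCompactSupport φ)
    (hφU : tsupport φ ⊆ U) (e : Space k) :
    IntegrableOn (tangentialDeriv M φ e) D μHE[k + 1] := by
  have hcl := isClosedEmbedding_graphMap R h.contDiff.continuous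
  have hd : Differentiable ℝ u := h.contDiff.differentiable (by simp)
  have h0 : ∀ q ∉ U, tangentialDeriv M φ e q = 0 := fun q hq =>
    tangentialDeriv_eq_zero (fun h' => hq (hφU h')) e
  rw [← integrable_indicator_iff hD, h.indicator_bulk_eq hDM h0,
    integrable_indicator_iff hcl.isClosed_range.measurableSet]
  have key := integrableOn_range_iff hcl.measurableEmbedding
    ((contDiff_graphMap R h.contDiff).of_le (by simp)) (contDiff_areaElement h.contDiff).continuous
    (areaElement_pos u) (fun x => normDet_fderiv_graphMap R (hd x))
    (D.indicator (tangentialDeriv M φ e))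
  rw [finrank_base] at key
  rw [key, h.bulk_indicator_density hmin hφ hφU,
    integrable_indicator_iff (hcl.continuous.measurable hD)]
  refine (Continuous.integrable_of_hasCompactSupport ?_ ?_).integrableOn
  · exact continuous_divergence (contDiff_testField h.contDiff hφ e)
  · exact hasCompactSupport_divergence (hasCompactSupport_testField h.contDiff hφc e)

theorem IsGraphChart.setIntegral_bulk (h : IsGraphChart M U R u) (hmin : IsMinimal M)
    (hDM : D ⊆ M) (hD : MeasurableSet D) (hφ : ContDiff ℝ ∞ φ)
    (hφU : tsupport φ ⊆ U) (e : Space k) :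
    ∫ q in D, tangentialDeriv M φ e q ∂μHE[k + 1] =
      ∫ x in graphMap R u ⁻¹' D, divergence (testField R u φ e) x := by
  have hcl := isClosedEmbedding_graphMap R h.contDiff.continuous
  have hd : Differentiable ℝ u := h.contDiff.differentiable (by simp)
  have h0 : ∀ q ∉ U, tangentialDeriv M φ e q = 0 := fun q hq =>
    tangentialDeriv_eq_zero (fun h' => hq (hφU h')) e
  rw [← integral_indicator hD, h.indicator_bulk_eq hDM h0,
    integral_indicator hcl.isClosed_range.measurableSet]
  have key := setIntegral_range_eq hcl.measurableEmbedding
    ((contDiff_graphMap R h.contDiff).of_le (by simp)) (contDiff_areaElement h.contDiff).continuous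
    (areaElement_pos u) (fun x => normDet_fderiv_graphMap R (hd x))
    (D.indicator (tangentialDeriv M φ e))
  rw [finrank_base] at key
  rw [key, h.bulk_indicator_density hmin hφ hφU,
    integral_indicator (hcl.continuous.measurable hD)]

theorem volume_level_eq_zero (t : ℝ) : volume {x : Base k | x.snd = t} = 0 := by
  have hemb : MeasurableEmbedding (WithLp.ofLp : Base k → EuclideanSpace ℝ (Fin k) × ℝ) :=
    (MeasurableEquiv.toLp 2 (EuclideanSpace ℝ (Fin k) × ℝ)).symm.measurableEmbedding
  have h := (WithLp.volume_preserving_ofLp (EuclideanSpace ℝ (Fin k)) ℝ).measure_preimage_emb hemb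
    (univ ×ˢ {t})
  have h2 : {x : Base k | x.snd = t} = WithLp.ofLp ⁻¹' (univ ×ˢ {t}) := by
    ext x; simp
  rw [h2, h, Measure.volume_eq_prod, Measure.prod_prod]
  simp

/-- Levels are null sets and the test field vanishes off the chart, so `D` has to be known only in
`U` and away from one level. Hence strict and weak inequalities are interchangeable, and `D` may
behave arbitrarily on the level itself. -/
theorem IsGraphChart.setIntegral_bulk_congr (h : IsGraphChart M U R u) {D' : Set (Base k)}
    (hD : MeasurableSet D) (hD' : MeasurableSet D') (hφU : tsupport φ ⊆ U) (e : Space k)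
    (hDD : ∀ x, graphMap R u x ∈ U → x.snd ≠ t → (graphMap R u x ∈ D ↔ x ∈ D')) :
    ∫ x in graphMap R u ⁻¹' D, divergence (testField R u φ e) x =
      ∫ x in D', divergence (testField R u φ e) x := by
  have hc := (isClosedEmbedding_graphMap R h.contDiff.continuous).continuous
  rw [← integral_indicator (hc.measurable hD), ← integral_indicator hD']
  refine integral_congr_ae ?_
  have hae : ∀ᵐ x : Base k, x.snd ≠ t := by
    rw [ae_iff]; simpa using volume_level_eq_zero t
  filter_upwards [hae] with x hx
  by_cases hU : graphMap R u x ∈ U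
  · have := hDD x hU hx
    by_cases hs : x ∈ D'
    · rw [indicator_of_mem (by exact this.2 hs), indicator_of_mem hs]
    · rw [indicator_of_notMem (by exact mt this.1 hs), indicator_of_notMem hs]
  · have h0 : divergence (testField R u φ e) x = 0 := by
      have h1 : testField R u φ e =ᶠ[𝓝 x] fun _ => 0 := by
        have h2 : graphMap R u x ∈ (tsupport φ)ᶜ := fun h' => hU (hφU h')
        filter_upwards [hc.continuousAt.preimage_mem_nhds
          ((isClosed_tsupport φ).isOpen_compl.mem_nhds h2)] with y hy
        rw [testField, image_eq_zero_of_notMem_tsupport hy, zero_smul]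
      rw [divergence, h1.fderiv_eq, fderiv_fun_const]
      simp
    simp [indicator, h0]

theorem measurableSet_halfspace (t : ℝ) : MeasurableSet {x : Base k | x.snd ≤ t} :=
  (isClosed_le (WithLp.continuous_snd 2 _ ℝ) continuous_const).measurableSet

/-- The divergence theorem for a test function supported in a chart that does not meet the
boundary. -/
theorem IsGraphChart.bulk_eq_zero_of_interior (h : IsGraphChart M U R u) (hmin : IsMinimal M)
    (hDM : D ⊆ M) (hD : MeasurableSet D) (hφ : ContDiff ℝ ∞ φ) (hφc : HasCompactSupport φ)
    (hφU : tsupport φ ⊆ U) (e : Space k)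
    (hDU : ∀ x, graphMap R u x ∈ U → x.snd ≠ t → graphMap R u x ∈ D) :
    ∫ q in D, tangentialDeriv M φ e q ∂μHE[k + 1] = 0 := by
  rw [h.setIntegral_bulk hmin hDM hD hφ hφU, h.setIntegral_bulk_congr (t := t) (D' := univ) hD
    MeasurableSet.univ hφU e (fun x hx ht => by simpa using hDU x hx ht), Measure.restrict_univ]
  exact integral_divergence_eq_zero (contDiff_testField h.contDiff hφ e)
    (hasCompactSupport_testField h.contDiff hφc e)

theorem IsGraphChart.bulk_eq_zero_of_exterior (h : IsGraphChart M U R u) (hmin : IsMinimal M)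
    (hDM : D ⊆ M) (hD : MeasurableSet D) (hφ : ContDiff ℝ ∞ φ)
    (hφU : tsupport φ ⊆ U) (e : Space k)
    (hDU : ∀ x, graphMap R u x ∈ U → x.snd ≠ t → graphMap R u x ∉ D) :
    ∫ q in D, tangentialDeriv M φ e q ∂μHE[k + 1] = 0 := by
  rw [h.setIntegral_bulk hmin hDM hD hφ hφU, h.setIntegral_bulk_congr (t := t) (D' := ∅) hD
    MeasurableSet.empty hφU e (fun x hx ht => by simpa using hDU x hx ht)]
  simp

/-- The divergence theorem for a test function supported in a chart in which the domain is the
part below a level. -/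
theorem IsGraphChart.bulk_eq_of_below (h : IsGraphChart M U R u) (hR : IsVertical R)
    (hmin : IsMinimal M)
    (hDM : D ⊆ M) (hD : MeasurableSet D) (hφ : ContDiff ℝ ∞ φ) (hφc : HasCompactSupport φ)
    (hφU : tsupport φ ⊆ U) (e : Space k)
    (hSm : MeasurableSet S) (hS : ∀ q ∈ U, q ∈ S ↔ q ∈ crossSection M t)
    (hDU : ∀ q ∈ U, q ∈ M → (q ∈ D ↔ height q < t)) :
    ∫ q in D, tangentialDeriv M φ e q ∂μHE[k + 1] =
      ∫ q in S, φ q * ⟪e, conormal M q⟫_ℝ ∂μHE[k] := by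
  rw [h.setIntegral_bulk hmin hDM hD hφ hφU, h.setIntegral_slice hR hSm hS hφU,
    h.setIntegral_bulk_congr (t := t) hD (measurableSet_halfspace t) hφU e (fun x hx ht => ?_)]
  · exact setIntegral_divergence_halfspace (contDiff_testField h.contDiff hφ e)
      (hasCompactSupport_testField h.contDiff hφc e) t
  · rw [hDU _ hx (h.graphMap_mem hx), hR.height_graphMap]
    exact ⟨fun h' => h'.le, fun h' => lt_of_le_of_ne h' ht⟩

/-- The divergence has total integral zero, so the upper half-space contributes the negative of the
lower one. -/
theorem IsGraphChart.bulk_eq_of_above (h : IsGraphChart M U R u) (hR : IsVertical R)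
    (hmin : IsMinimal M)
    (hDM : D ⊆ M) (hD : MeasurableSet D) (hφ : ContDiff ℝ ∞ φ) (hφc : HasCompactSupport φ)
    (hφU : tsupport φ ⊆ U) (e : Space k)
    (hSm : MeasurableSet S) (hS : ∀ q ∈ U, q ∈ S ↔ q ∈ crossSection M t)
    (hDU : ∀ q ∈ U, q ∈ M → (q ∈ D ↔ t < height q)) :
    ∫ q in D, tangentialDeriv M φ e q ∂μHE[k + 1] =
      -∫ q in S, φ q * ⟪e, conormal M q⟫_ℝ ∂μHE[k] := by
  have hF := contDiff_testField (R := R) h.contDiff hφ e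
  have hFc := hasCompactSupport_testField (R := R) h.contDiff hφc e
  rw [h.setIntegral_bulk hmin hDM hD hφ hφU, h.setIntegral_slice hR hSm hS hφU,
    h.setIntegral_bulk_congr (t := t) hD (measurableSet_halfspace t).compl hφU e
      (fun x hx ht => ?_)]
  · rw [← setIntegral_divergence_halfspace hF hFc t, eq_neg_iff_add_eq_zero, add_comm,
      integral_add_compl (measurableSet_halfspace t)]
    · exact integral_divergence_eq_zero hF hFc
    · exact (continuous_divergence hF).integrable_of_hasCompactSupport
        (hasCompactSupport_divergence hFc)
  · rw [hDU _ hx (h.graphMap_mem hx), hR.height_graphMap]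
    simp

end LocalFormulas

/-! ### Existence of charts, vertical at regular points. -/

section ExistenceOfCharts

variable {k : ℕ} {M : Set (Space k)}

/-- A pair of orthonormal vectors extends to an orthonormal frame of the ambient space. -/
theorem exists_frame {a w : Space k} (ha : ‖a‖ = 1) (hw : ‖w‖ = 1) (haw : ⟪a, w⟫_ℝ = 0) :
    ∃ R : WithLp 2 (Base k × ℝ) ≃ₗᵢ[ℝ] Space k,
      R (WithLp.toLp 2 (baseAxis k, 0)) = a ∧ R (WithLp.toLp 2 (0, 1)) = w := by
  have hon : Orthonormal ℝ ![a, w] := by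
    rw [orthonormal_iff_ite]
    intro i j
    fin_cases i <;> fin_cases j <;> simp [ha, hw, haw, real_inner_comm]
  set S := Submodule.span ℝ (range ![a, w]) with hS
  have hrank : Module.finrank ℝ Sᗮ = k := by
    have h1 := S.finrank_add_finrank_orthogonal
    have h2 := finrank_span_eq_card hon.linearIndependent
    rw [← hS] at h2
    simp at h1 h2
    omega
  let j : EuclideanSpace ℝ (Fin k) ≃ₗᵢ[ℝ] Sᗮ :=
    ((stdOrthonormalBasis ℝ Sᗮ).reindex (finCongr hrank)).repr.symm
  have ha' : a ∈ S := Submodule.subset_span ⟨0, rfl⟩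
  have hw' : w ∈ S := Submodule.subset_span ⟨1, rfl⟩
  let L : WithLp 2 (Base k × ℝ) →ₗ[ℝ] Space k :=
    { toFun := fun x => (j x.fst.fst : Space k) + x.fst.snd • a + x.snd • w
      map_add' := fun x y => by simp [add_smul]; abel
      map_smul' := fun c x => by simp [mul_smul] }
  have hL : ∀ x, ‖L x‖ = ‖x‖ := by
    intro x
    have h1 : ⟪(j x.fst.fst : Space k), a⟫_ℝ = 0 :=
      Submodule.inner_left_of_mem_orthogonal ha' (j x.fst.fst).2
    have h2 : ⟪(j x.fst.fst : Space k), w⟫_ℝ = 0 :=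
      Submodule.inner_left_of_mem_orthogonal hw' (j x.fst.fst).2
    have hj : ‖(j x.fst.fst : Space k)‖ = ‖x.fst.fst‖ := j.norm_map _
    rw [← sq_eq_sq₀ (norm_nonneg _) (norm_nonneg _)]
    rw [WithLp.prod_norm_sq_eq_of_L2, WithLp.prod_norm_sq_eq_of_L2]
    change ‖(j x.fst.fst : Space k) + x.fst.snd • a + x.snd • w‖ ^ 2 = _
    rw [norm_add_sq_real, norm_add_sq_real, inner_add_left, real_inner_smul_right,
      real_inner_smul_right, real_inner_smul_right, real_inner_smul_left, h1, h2, haw,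
      norm_smul, norm_smul, ha, hw, hj]
    ring
  let Li : WithLp 2 (Base k × ℝ) →ₗᵢ[ℝ] Space k := ⟨L, hL⟩
  have hfr : Module.finrank ℝ (WithLp 2 (Base k × ℝ)) = Module.finrank ℝ (Space k) := by
    rw [(WithLp.prodContinuousLinearEquiv 2 ℝ (Base k) ℝ).toLinearEquiv.finrank_eq]
    simp [finrank_base]
  refine ⟨Li.toLinearIsometryEquiv hfr, ?_, ?_⟩
  · change (j (baseAxis k).fst : Space k) + (baseAxis k).snd • a + (0 : ℝ) • w = a
    simp [baseAxis]
  · change (j ((0 : Base k).fst) : Space k) + (0 : Base k).snd • a + (1 : ℝ) • w = w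
    simp

theorem norm_axis : ‖axis k‖ = 1 := by simp [axis]

/-- Since `g` is constant on `M ∩ U`, its derivative maps the tangent cone into that of a single
point, which is zero. -/
theorem IsLocalDefiningFunction.inner_gradient_eq_zero {U : Set (Space k)} {g : Space k → ℝ}
    (hg : IsLocalDefiningFunction M U g) {p v : Space k} (hp : p ∈ U) (hpM : p ∈ M)
    (hv : v ∈ tangentSpace M p) : ⟪∇ g p, v⟫_ℝ = 0 := by
  suffices h : tangentSpace M p ≤ (ℝ ∙ ∇ g p)ᗮ from
    Submodule.mem_orthogonal_singleton_iff_inner_right.1 (h hv)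
  rw [tangentSpace, Submodule.span_le]
  intro v hv
  rw [SetLike.mem_coe, Submodule.mem_orthogonal_singleton_iff_inner_right]
  have hd : HasFDerivAt g (fderiv ℝ g p) p :=
    ((hg.contDiffOn.contDiffAt (hg.isOpen.mem_nhds hp)).differentiableAt (by simp)).hasFDerivAt
  rw [← tangentConeAt_inter_nhds (hg.isOpen.mem_nhds hp)] at hv
  have h := hd.hasFDerivWithinAt.mapsTo_tangent_cone hv
  have h0 : ¬AccPt (g p) (𝓟 (g '' (M ∩ U))) := by
    have hs : g '' (M ∩ U) ⊆ {g p} := by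
      rintro _ ⟨y, hy, rfl⟩
      have hpU : p ∈ M ∩ U := ⟨hpM, hp⟩
      rw [hg.inter_eq] at hy hpU
      rw [mem_singleton_iff, hy.2, hpU.2]
    intro hacc
    have h1 := hacc.mono (principal_mono.2 hs)
    rw [accPt_iff_nhds] at h1
    obtain ⟨y, hy, hy0⟩ := h1 univ univ_mem
    exact hy0 hy.2
  have h2 := tangentConeAt_subset_zero h0 h
  rw [inner_gradient_eq]
  simpa using h2

/-- Used at points off the cycles, where the height may be critical on `M`. The frame need not be
vertical there: any unit vector orthogonal to the normal will do. -/
theorem exists_chart (hM : IsEmbeddedHypersurface M) {p : Space k} (hp : p ∈ M) :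
    ∃ (R : WithLp 2 (Base k × ℝ) ≃ₗᵢ[ℝ] Space k) (U : Set (Space k)) (u : Base k → ℝ),
      p ∈ U ∧ IsGraphChart M U R u := by
  obtain ⟨U, g, hpU, hg⟩ := hM p hp
  have hn := hg.gradient_ne_zero p hpU
  set w := ‖∇ g p‖⁻¹ • ∇ g p with hw
  have hw1 : ‖w‖ = 1 := norm_smul_inv_norm (𝕜 := ℝ) hn
  obtain ⟨b, hb, hb0⟩ : ∃ b ∈ (ℝ ∙ w)ᗮ, b ≠ 0 := by
    refine Submodule.exists_mem_ne_zero_of_ne_bot fun h => ?_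
    have h1 := (ℝ ∙ w).finrank_add_finrank_orthogonal
    have h2 := finrank_span_le_card (R := ℝ) ({w} : Set (Space k))
    rw [h] at h1
    simp at h1 h2
    omega
  have hb' : ⟪w, b⟫_ℝ = 0 := Submodule.mem_orthogonal_singleton_iff_inner_right.1 hb
  obtain ⟨R, -, hR⟩ := exists_frame (a := ‖b‖⁻¹ • b) (w := w) (norm_smul_inv_norm (𝕜 := ℝ) hb0)
    hw1 (by rw [real_inner_smul_left, real_inner_comm, hb', mul_zero])
  obtain ⟨U', u, hpU', hU'⟩ := exists_isGraphChart hg hpU hp R (by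
    rw [hR, hw, real_inner_smul_right, real_inner_self_eq_norm_sq]
    have := norm_pos_iff.2 hn
    positivity)
  exact ⟨R, U', u, hpU', hU'⟩

/-- Regularity means that `∇g` is not parallel to `e_n`. Its component `w₀` orthogonal to `e_n` is
then nonzero, and `M` is a graph in the direction of `w₀`, with `e_n` left in the base. -/
theorem exists_vertical_chart (hM : IsEmbeddedHypersurface M) {p : Space k} (hp : p ∈ M)
    (hreg : ∃ v ∈ tangentSpace M p, height v ≠ 0) :
    ∃ (R : WithLp 2 (Base k × ℝ) ≃ₗᵢ[ℝ] Space k) (U : Set (Space k)) (u : Base k → ℝ),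
      p ∈ U ∧ IsGraphChart M U R u ∧ IsVertical R := by
  obtain ⟨U, g, hpU, hg⟩ := hM p hp
  have hn := hg.gradient_ne_zero p hpU
  obtain ⟨v, hv, hv0⟩ := hreg
  have hgv := hg.inner_gradient_eq_zero hpU hp hv
  set c := ⟪axis k, ∇ g p⟫_ℝ with hc
  set w₀ := ∇ g p - c • axis k with hw₀
  have haa : ⟪axis k, axis k⟫_ℝ = 1 := by rw [real_inner_self_eq_norm_sq, norm_axis, one_pow]
  have haw : ⟪axis k, w₀⟫_ℝ = 0 := by
    rw [hw₀, inner_sub_right, real_inner_smul_right, haa, ← hc]; ring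
  have hw0 : w₀ ≠ 0 := by
    intro h
    have h1 : ∇ g p = c • axis k := sub_eq_zero.1 h
    rw [h1, real_inner_smul_left, inner_axis] at hgv
    rcases mul_eq_zero.1 hgv with h2 | h2
    · exact hn (by rw [h1, h2, zero_smul])
    · exact hv0 h2
  have hgw : ⟪∇ g p, w₀⟫_ℝ = ‖w₀‖ ^ 2 := by
    have : ∇ g p = w₀ + c • axis k := by rw [hw₀]; abel
    rw [this, inner_add_left, real_inner_smul_left, haw, real_inner_self_eq_norm_sq]
    ring
  obtain ⟨R, hR1, hR⟩ := exists_frame (a := axis k) (w := ‖w₀‖⁻¹ • w₀) norm_axis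
    (norm_smul_inv_norm (𝕜 := ℝ) hw0) (by rw [real_inner_smul_right, haw, mul_zero])
  obtain ⟨U', u, hpU', hU'⟩ := exists_isGraphChart hg hpU hp R (by
    rw [hR, real_inner_smul_right, hgw]
    have := norm_pos_iff.2 hw0
    positivity)
  exact ⟨R, U', u, hpU', hU', hR1⟩

end ExistenceOfCharts

/-! ### Components of a regular cross-section. -/

section Components

variable {k : ℕ} {M U : Set (Space k)} {R : WithLp 2 (Base k × ℝ) ≃ₗᵢ[ℝ] Space k}
  {u : Base k → ℝ} {t : ℝ}

theorem isClosed_connectedComponentIn {X : Type*} [TopologicalSpace X] {F : Set X}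
    (hF : IsClosed F) (x : X) : IsClosed (connectedComponentIn F x) := by
  by_cases hx : x ∈ F
  · refine isClosed_of_closure_subset ?_
    exact isPreconnected_connectedComponentIn.closure.subset_connectedComponentIn
      (subset_closure (mem_connectedComponentIn hx))
      (closure_minimal (connectedComponentIn_subset F x) hF)
  · rw [connectedComponentIn_eq_empty hx]
    exact isClosed_empty

/-- Near `p` the section is the image of a ball under the slice map, hence connected. So components
of a regular section are relatively open. -/
theorem IsGraphChart.exists_nhds_subset_component (h : IsGraphChart M U R u) (hR : IsVertical R)
    {p : Space k} (hpU : p ∈ U) (hp : p ∈ crossSection M t) :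
    ∃ U', IsOpen U' ∧ p ∈ U' ∧ U' ∩ crossSection M t ⊆ connectedComponentIn (crossSection M t) p := by
  have hcl := isClosedEmbedding_sliceMap (R := R) h.contDiff.continuous t
  obtain ⟨z, rfl⟩ := (hR.mem_range_sliceMap h hpU).2 hp
  obtain ⟨r, hr, hrU⟩ := Metric.isOpen_iff.1 (h.isOpen.preimage hcl.continuous) z hpU
  set π : Space k → EuclideanSpace ℝ (Fin k) := fun q => (baseProj R q).fst
  have hπ : Continuous π := (WithLp.continuous_fst 2 _ ℝ).comp (baseProj R).continuous
  have hπs : ∀ z, π (sliceMap R u t z) = z := fun z => by simp [π, sliceMap]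
  refine ⟨U ∩ π ⁻¹' Metric.ball z r, h.isOpen.inter (Metric.isOpen_ball.preimage hπ),
    ⟨hpU, by simpa [hπs] using hr⟩, ?_⟩
  have hsub : sliceMap R u t '' Metric.ball z r ⊆
      connectedComponentIn (crossSection M t) (sliceMap R u t z) := by
    refine IsPreconnected.subset_connectedComponentIn ?_ ?_ ?_
    · exact (convex_ball z r).isPreconnected.image _ hcl.continuous.continuousOn
    · exact ⟨z, Metric.mem_ball_self hr, rfl⟩
    · rintro _ ⟨y, hy, rfl⟩
      exact (hR.mem_range_sliceMap h (hrU hy)).1 ⟨y, rfl⟩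
  rintro q ⟨⟨hqU, hqπ⟩, hq⟩
  obtain ⟨y, rfl⟩ := (hR.mem_range_sliceMap h hqU).2 hq
  refine hsub ⟨y, ?_, rfl⟩
  simpa [hπs] using hqπ

theorem exists_nhds_subset_component (hM : IsEmbeddedHypersurface M) (ht : IsRegularValue M t)
    {p : Space k} (hp : p ∈ crossSection M t) :
    ∃ U', IsOpen U' ∧ p ∈ U' ∧
      U' ∩ crossSection M t ⊆ connectedComponentIn (crossSection M t) p := by
  obtain ⟨R, U, u, hpU, hU, hR⟩ := exists_vertical_chart hM hp.1 (ht p hp)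
  exact hU.exists_nhds_subset_component hR hpU hp

/-- `S` is a compact relatively open part of the regular cross-section at the level `t`. -/
structure IsSectionPart (M : Set (Space k)) (t : ℝ) (S : Set (Space k)) : Prop where
  regular : IsRegularValue M t
  isCompact : IsCompact S
  subset : S ⊆ crossSection M t
  exists_nhds : ∀ p ∈ S, ∃ U, IsOpen U ∧ p ∈ U ∧ U ∩ crossSection M t ⊆ S

theorem IsComponent.isSectionPart (hM : IsEmbeddedHypersurface M) (ht : IsRegularValue M t)
    (hc : IsCompact (crossSection M t)) {C : Set (Space k)} (hC : IsComponent M t C) :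
    IsSectionPart M t C := by
  obtain ⟨p, hp, rfl⟩ := hC
  refine ⟨ht, ?_, connectedComponentIn_subset _ _, fun q hq => ?_⟩
  · exact hc.of_isClosed_subset (isClosed_connectedComponentIn hc.isClosed p)
      (connectedComponentIn_subset _ _)
  · obtain ⟨U', hU', hqU', hsub⟩ := exists_nhds_subset_component hM ht
      (connectedComponentIn_subset _ _ hq)
    exact ⟨U', hU', hqU', by rwa [connectedComponentIn_eq hq]⟩

theorem IsCycle.exists_isSectionPart (hM : IsEmbeddedHypersurface M) {T : Set ℝ}
    (hT : IsTube M T) {S : Set (Space k)} (hS : IsCycle M T S) :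
    ∃ t ∈ T, IsSectionPart M t S := by
  obtain ⟨t, htT, ht, m, C, hC, rfl⟩ := hS
  have hp := fun i => (hC i).isSectionPart hM ht (hT.isCompact_crossSection t htT)
  refine ⟨t, htT, ht, isCompact_iUnion fun i => (hp i).isCompact,
    iUnion_subset fun i => (hp i).subset, fun p hpC => ?_⟩
  obtain ⟨i, hi⟩ := mem_iUnion.1 hpC
  obtain ⟨U, hU, hpU, hsub⟩ := (hp i).exists_nhds p hi
  exact ⟨U, hU, hpU, hsub.trans (subset_iUnion C i)⟩

/-- Relatively open components cover a compact set, so finitely many suffice. Different points of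
the subcover may yield the same component; `IsCycle` allows repetitions. -/
theorem isCycle_crossSection (hM : IsEmbeddedHypersurface M) {T : Set ℝ}
    (hT : IsTube M T) (htT : t ∈ T) (ht : IsRegularValue M t) :
    IsCycle M T (crossSection M t) := by
  have hc := hT.isCompact_crossSection t htT
  choose! U hUo hpU hsub using fun p (hp : p ∈ crossSection M t) =>
    exists_nhds_subset_component hM ht hp
  obtain ⟨F, hF, hcov⟩ := hc.elim_nhds_subcover U fun p hp => (hUo p hp).mem_nhds (hpU p hp)
  refine ⟨t, htT, ht, F.card, fun i => connectedComponentIn (crossSection M t) (F.equivFin.symm i),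
    fun i => ⟨_, hF _ (F.equivFin.symm i).2, rfl⟩, ?_⟩
  refine Subset.antisymm (fun q hq => ?_) (iUnion_subset fun i => connectedComponentIn_subset _ _)
  obtain ⟨p, hpF, hqp⟩ := mem_iUnion₂.1 (hcov hq)
  refine mem_iUnion.2 ⟨F.equivFin ⟨p, hpF⟩, ?_⟩
  simpa using hsub p (hF p hpF) ⟨hqp, hq⟩

theorem IsComponent.disjoint {C C' : Set (Space k)} (hC : IsComponent M t C)
    (hC' : IsComponent M t C') (hne : C ≠ C') : Disjoint C C' := by
  obtain ⟨p, hp, rfl⟩ := hC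
  obtain ⟨p', hp', rfl⟩ := hC'
  rw [Set.disjoint_left]
  intro q hq hq'
  exact hne ((connectedComponentIn_eq hq).trans (connectedComponentIn_eq hq').symm)

end Components

/-! ### Smooth partitions of unity. -/

section Partition

/-- A finite smooth partition of unity near a compact set, subordinate to given neighbourhoods of
its points. -/
theorem exists_partition_of_unity {E : Type*} [NormedAddCommGroup E] [NormedSpace ℝ E]
    [FiniteDimensional ℝ E] {K : Set E} (hK : IsCompact K) {U : E → Set E}
    (hU : ∀ p ∈ K, IsOpen (U p)) (hpU : ∀ p ∈ K, p ∈ U p) :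
    ∃ (s : Finset E) (φ : s → E → ℝ), (∀ i : s, (i : E) ∈ K) ∧ (∀ i, ContDiff ℝ ∞ (φ i)) ∧
      (∀ i, HasCompactSupport (φ i)) ∧ (∀ i, tsupport (φ i) ⊆ U i) ∧
      ∀ q ∈ K, ∀ᶠ y in 𝓝 q, ∑ i, φ i y = 1 := by
  -- The unit balls force the supports to be compact.
  set B : E → Set E := fun p => U p ∩ Metric.ball p 1
  have hBo : ∀ p ∈ K, IsOpen (B p) := fun p hp => (hU p hp).inter Metric.isOpen_ball
  have hpB : ∀ p ∈ K, p ∈ B p := fun p hp => ⟨hpU p hp, Metric.mem_ball_self one_pos⟩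
  obtain ⟨s, hs, hcov⟩ := hK.elim_nhds_subcover B fun p hp => (hBo p hp).mem_nhds (hpB p hp)
  have hso : IsOpen (⋃ i : s, B i) := isOpen_iUnion fun i => hBo i (hs i i.2)
  have hcov' : K ⊆ ⋃ i : s, B i := fun q hq => by
    obtain ⟨p, hp, hqp⟩ := mem_iUnion₂.1 (hcov hq)
    exact mem_iUnion.2 ⟨⟨p, hp⟩, hqp⟩
  have : ProperSpace E := FiniteDimensional.proper ℝ E
  -- Partitioning over a compact neighbourhood `L` of `K` makes the sum equal to `1` near each point
  -- of `K`, so that it can be differentiated there.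
  obtain ⟨L, hL, hKL, hLU⟩ := exists_compact_between hK hso hcov'
  obtain ⟨f, hf⟩ := SmoothPartitionOfUnity.exists_isSubordinate (modelWithCornersSelf ℝ E)
    hL.isClosed (fun i : s => B i) (fun i : s => hBo i (hs i i.2)) hLU
  refine ⟨s, fun i => f i, fun i => hs i i.2, fun i => (f i).contMDiff.contDiff, fun i => ?_,
    fun i => (hf i).trans inter_subset_left, fun q hq => ?_⟩
  · refine HasCompactSupport.of_support_subset_isCompact (isCompact_closedBall (i : E) 1) ?_
    exact (subset_tsupport _).trans
      (((hf i).trans inter_subset_right).trans Metric.ball_subset_closedBall)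
  · filter_upwards [mem_interior_iff_mem_nhds.1 (hKL hq)] with y hy
    rw [← f.sum_eq_one hy, finsum_eq_sum_of_fintype]

end Partition

/-! ### Convergence of the flow integrals. -/

section Flow

variable {k : ℕ} {M S : Set (Space k)} {t : ℝ}

/-- The chart is shrunk until no other part of the section meets it. -/
theorem IsSectionPart.exists_vertical_chart (hS : IsSectionPart M t S)
    (hM : IsEmbeddedHypersurface M) {p : Space k} (hp : p ∈ S) :
    ∃ (R : WithLp 2 (Base k × ℝ) ≃ₗᵢ[ℝ] Space k) (U : Set (Space k)) (u : Base k → ℝ),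
      p ∈ U ∧ IsGraphChart M U R u ∧ IsVertical R ∧
        ∀ q ∈ U, q ∈ S ↔ q ∈ crossSection M t := by
  obtain ⟨R, U, u, hpU, hU, hR⟩ := MinimalTube.exists_vertical_chart hM (hS.subset hp).1
    (hS.regular p (hS.subset hp))
  obtain ⟨U', hU', hpU', hsub⟩ := hS.exists_nhds p hp
  refine ⟨R, U ∩ U', u, ⟨hpU, hpU'⟩, hU.mono (hU.isOpen.inter hU') inter_subset_left, hR,
    fun q hq => ⟨fun h => hS.subset h, fun h => hsub ⟨hq.2, h⟩⟩⟩

theorem integrableOn_of_tsupport_subset_compl {φ : Space k → ℝ} (h : tsupport φ ⊆ Sᶜ)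
    (hS : MeasurableSet S) (e : Space k) :
    IntegrableOn (fun q => φ q * ⟪e, conormal M q⟫_ℝ) S μHE[k] :=
  integrableOn_zero.congr_fun (fun q hq => by
    rw [image_eq_zero_of_notMem_tsupport fun h' => h h' hq, zero_mul]) hS

theorem setIntegral_of_tsupport_subset_compl {φ : Space k → ℝ} (h : tsupport φ ⊆ Sᶜ)
    (e : Space k) :
    ∫ q in S, φ q * ⟪e, conormal M q⟫_ℝ ∂μHE[k] = 0 :=
  setIntegral_eq_zero_of_forall_eq_zero fun q hq => by
    rw [image_eq_zero_of_notMem_tsupport fun h' => h h' hq, zero_mul]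

theorem IsSectionPart.exists_nhds_integrableOn (hS : IsSectionPart M t S)
    (hM : IsEmbeddedHypersurface M) (p : Space k) :
    ∃ U, IsOpen U ∧ p ∈ U ∧ ∀ φ : Space k → ℝ, ContDiff ℝ ∞ φ → HasCompactSupport φ →
      tsupport φ ⊆ U → ∀ e, IntegrableOn (fun q => φ q * ⟪e, conormal M q⟫_ℝ) S μHE[k] := by
  by_cases hp : p ∈ S
  · obtain ⟨R, U, u, hpU, hU, hR, hUS⟩ := hS.exists_vertical_chart hM hp
    exact ⟨U, hU.isOpen, hpU, fun φ hφ hφc hφU e =>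
      hU.integrableOn_slice hR hS.isCompact.measurableSet hUS hφ hφc hφU e⟩
  · exact ⟨Sᶜ, hS.isCompact.isClosed.isOpen_compl, hp, fun φ _ _ hφU e =>
      integrableOn_of_tsupport_subset_compl hφU hS.isCompact.measurableSet e⟩

/-- The unit conormal of a compact part of a regular cross-section is integrable. -/
theorem IsSectionPart.integrableOn_conormal (hS : IsSectionPart M t S)
    (hM : IsEmbeddedHypersurface M) : IntegrableOn (conormal M) S μHE[k] := by
  have hscalar : ∀ e, IntegrableOn (fun q => ⟪e, conormal M q⟫_ℝ) S μHE[k] := by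
    intro e
    choose U hUo hpU hint using hS.exists_nhds_integrableOn hM
    obtain ⟨s, φ, -, hφ, hφc, hφU, hsum⟩ := exists_partition_of_unity hS.isCompact
      (fun p _ => hUo p) (fun p _ => hpU p)
    have h1 : IntegrableOn (fun q => ∑ i, φ i q * ⟪e, conormal M q⟫_ℝ) S μHE[k] :=
      integrable_finsetSum _ fun i _ => hint i (φ i) (hφ i) (hφc i) (hφU i) e
    refine h1.congr_fun (fun q hq => ?_) hS.isCompact.measurableSet
    change ∑ i, φ i q * ⟪e, conormal M q⟫_ℝ = _
    rw [← Finset.sum_mul, (hsum q hq).self_of_nhds, one_mul]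
  set b := stdOrthonormalBasis ℝ (Space k)
  have h2 : conormal M = fun q => ∑ i, ⟪b i, conormal M q⟫_ℝ • b i := by
    ext1 q
    exact (b.sum_repr' _).symm
  rw [h2]
  exact integrable_finsetSum _ fun i _ => (hscalar (b i)).smul_const (b i)

theorem flowFunctional_eq_inner (h : IntegrableOn (conormal M) S μHE[k]) (e : Space k) :
    flowFunctional M S e = ⟪e, ∫ q in S, conormal M q ∂μHE[k]⟫_ℝ :=
  integral_inner h e

/-- As a vector-valued integral the flow vector inherits additivity over disjoint sets. -/
theorem flowVector_eq_setIntegral (h : IntegrableOn (conormal M) S μHE[k]) :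
    flowVector M S = ∫ q in S, conormal M q ∂μHE[k] := by
  ext i
  change flowFunctional M S (EuclideanSpace.single i (1 : ℝ)) = _
  rw [flowFunctional_eq_inner h, EuclideanSpace.inner_single_left]
  simp

end Flow

/-! ### Bordism invariance of the flow vector. -/

section Bordism

variable {k : ℕ} {M S' S'' D : Set (Space k)} {t' t'' : ℝ}

/-- The divergence theorem for a bordism, localized near a point. -/
theorem exists_nhds_flux_eq (hM : IsEmbeddedHypersurface M) (hmin : IsMinimal M)
    (hS' : IsSectionPart M t' S') (hS'' : IsSectionPart M t'' S'')
    (hDm : MeasurableSet D) (hDM : D ⊆ M) (hDo : ∃ O, IsOpen O ∧ D = M ∩ O)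
    (hbd : (M ∩ closure D) \ D ⊆ S' ∪ S'')
    (hb' : ∀ p ∈ S' \ S'', ∀ᶠ q in 𝓝[M] p, q ∈ D ↔ height p < height q)
    (hb'' : ∀ p ∈ S'' \ S', ∀ᶠ q in 𝓝[M] p, q ∈ D ↔ height q < height p)
    (hb : ∀ p ∈ S' ∩ S'',
      (∀ᶠ q in 𝓝[{q ∈ M | height q ≠ height p}] p, q ∈ D) ∨
      (∀ᶠ q in 𝓝[{q ∈ M | height q ≠ height p}] p, q ∉ D))
    {p : Space k} (hp : p ∈ (M ∩ closure D) ∪ (S' ∪ S'')) :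
    ∃ U, IsOpen U ∧ p ∈ U ∧ ∀ φ : Space k → ℝ, ContDiff ℝ ∞ φ → HasCompactSupport φ →
      tsupport φ ⊆ U → ∀ e, IntegrableOn (tangentialDeriv M φ e) D μHE[k + 1] ∧
        ∫ q in D, tangentialDeriv M φ e q ∂μHE[k + 1] =
          ∫ q in S'', φ q * ⟪e, conormal M q⟫_ℝ ∂μHE[k] -
            ∫ q in S', φ q * ⟪e, conormal M q⟫_ℝ ∂μHE[k] := by
  have hm' := hS'.isCompact.measurableSet
  have hm'' := hS''.isCompact.measurableSet
  by_cases h1 : p ∈ S'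
  · obtain ⟨R, U, u, hpU, hU, hR, hUS'⟩ := hS'.exists_vertical_chart hM h1
    by_cases h2 : p ∈ S''
    · obtain ⟨R₂, U₂, u₂, hpU₂, hU₂, -, hUS''⟩ := hS''.exists_vertical_chart hM h2
      have ht : t' = t'' := (hS'.subset h1).2.symm.trans (hS''.subset h2).2
      subst ht
      have hpt : height p = t' := (hS'.subset h1).2
      -- At a common point both cycles coincide locally with the same section, so their
      -- contributions cancel. It remains to see that the bulk term vanishes, whether `D` lies on
      -- both sides or on neither.
      have key : ∀ U', IsOpen U' → U' ⊆ U ∩ U₂ → ∀ φ : Space k → ℝ, tsupport φ ⊆ U' → ∀ e,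
          ∫ q in S'', φ q * ⟪e, conormal M q⟫_ℝ ∂μHE[k] -
            ∫ q in S', φ q * ⟪e, conormal M q⟫_ℝ ∂μHE[k] = 0 := by
        intro U' hU'o hU' φ hφU e
        have hU'c := hU.mono hU'o (hU'.trans inter_subset_left)
        rw [hU'c.setIntegral_slice hR hm' (fun q hq => hUS' q (hU' hq).1) hφU,
          hU'c.setIntegral_slice hR hm'' (fun q hq => hUS'' q (hU' hq).2) hφU, sub_self]
      rcases hb p ⟨h1, h2⟩ with h | h
      · obtain ⟨O, hO, hpO, hOD⟩ := mem_nhdsWithin.1 h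
        set U' := (U ∩ U₂) ∩ O
        have hU'o : IsOpen U' := (hU.isOpen.inter hU₂.isOpen).inter hO
        have hU'c := hU.mono hU'o (inter_subset_left.trans inter_subset_left)
        refine ⟨U', hU'o, ⟨⟨hpU, hpU₂⟩, hpO⟩, fun φ hφ hφc hφU e =>
          ⟨hU'c.integrableOn_bulk hmin hDM hDm hφ hφc hφU e, ?_⟩⟩
        rw [key U' hU'o inter_subset_left φ hφU e]
        refine hU'c.bulk_eq_zero_of_interior (t := t') hmin hDM hDm hφ hφc hφU e fun x hx ht => ?_
        exact hOD ⟨hx.2, hU'c.graphMap_mem hx, by rwa [hR.height_graphMap, hpt]⟩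
      · obtain ⟨O, hO, hpO, hOD⟩ := mem_nhdsWithin.1 h
        set U' := (U ∩ U₂) ∩ O
        have hU'o : IsOpen U' := (hU.isOpen.inter hU₂.isOpen).inter hO
        have hU'c := hU.mono hU'o (inter_subset_left.trans inter_subset_left)
        refine ⟨U', hU'o, ⟨⟨hpU, hpU₂⟩, hpO⟩, fun φ hφ hφc hφU e =>
          ⟨hU'c.integrableOn_bulk hmin hDM hDm hφ hφc hφU e, ?_⟩⟩
        rw [key U' hU'o inter_subset_left φ hφU e]
        refine hU'c.bulk_eq_zero_of_exterior (t := t') hmin hDM hDm hφ hφU e fun x hx ht => ?_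
        exact hOD ⟨hx.2, hU'c.graphMap_mem hx, by rwa [hR.height_graphMap, hpt]⟩
    · obtain ⟨O, hO, hpO, hOD⟩ := mem_nhdsWithin.1 (hb' p ⟨h1, h2⟩)
      have hpt : height p = t' := (hS'.subset h1).2
      set U' := (U ∩ S''ᶜ) ∩ O
      have hU'o : IsOpen U' := (hU.isOpen.inter hS''.isCompact.isClosed.isOpen_compl).inter hO
      have hU'c := hU.mono hU'o (inter_subset_left.trans inter_subset_left)
      refine ⟨U', hU'o, ⟨⟨hpU, h2⟩, hpO⟩, fun φ hφ hφc hφU e =>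
        ⟨hU'c.integrableOn_bulk hmin hDM hDm hφ hφc hφU e, ?_⟩⟩
      rw [setIntegral_of_tsupport_subset_compl (S := S'')
        (hφU.trans (inter_subset_left.trans inter_subset_right)), zero_sub]
      refine hU'c.bulk_eq_of_above hR hmin hDM hDm hφ hφc hφU e hm'
        (fun q hq => hUS' q hq.1.1) fun q hq hqM => ?_
      rw [← hpt]
      exact hOD ⟨hq.2, hqM⟩
  · by_cases h2 : p ∈ S''
    · obtain ⟨R, U, u, hpU, hU, hR, hUS''⟩ := hS''.exists_vertical_chart hM h2
      obtain ⟨O, hO, hpO, hOD⟩ := mem_nhdsWithin.1 (hb'' p ⟨h2, h1⟩)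
      have hpt : height p = t'' := (hS''.subset h2).2
      set U' := (U ∩ S'ᶜ) ∩ O
      have hU'o : IsOpen U' := (hU.isOpen.inter hS'.isCompact.isClosed.isOpen_compl).inter hO
      have hU'c := hU.mono hU'o (inter_subset_left.trans inter_subset_left)
      refine ⟨U', hU'o, ⟨⟨hpU, h1⟩, hpO⟩, fun φ hφ hφc hφU e =>
        ⟨hU'c.integrableOn_bulk hmin hDM hDm hφ hφc hφU e, ?_⟩⟩
      rw [setIntegral_of_tsupport_subset_compl (S := S')
        (hφU.trans (inter_subset_left.trans inter_subset_right)), sub_zero]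
      refine hU'c.bulk_eq_of_below hR hmin hDM hDm hφ hφc hφU e hm''
        (fun q hq => hUS'' q hq.1.1) fun q hq hqM => ?_
      rw [← hpt]
      exact hOD ⟨hq.2, hqM⟩
    · have hpM : p ∈ M ∩ closure D := hp.resolve_right (by simp [h1, h2])
      -- A point of `closure D` in `M` off both cycles cannot be a boundary point of `D`.
      have hpD : p ∈ D := by
        by_contra h
        rcases hbd ⟨hpM, h⟩ with h' | h'
        exacts [h1 h', h2 h']
      obtain ⟨O, hO, hDO⟩ := hDo
      obtain ⟨R, U, u, hpU, hU⟩ := exists_chart hM hpM.1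
      set U' := (U ∩ (S'ᶜ ∩ S''ᶜ)) ∩ O
      have hU'o : IsOpen U' := (hU.isOpen.inter (hS'.isCompact.isClosed.isOpen_compl.inter
        hS''.isCompact.isClosed.isOpen_compl)).inter hO
      have hU'c := hU.mono hU'o (inter_subset_left.trans inter_subset_left)
      have hU'S : U' ⊆ S'ᶜ ∩ S''ᶜ := inter_subset_left.trans inter_subset_right
      refine ⟨U', hU'o, ⟨⟨hpU, h1, h2⟩, (hDO ▸ hpD).2⟩, fun φ hφ hφc hφU e =>
        ⟨hU'c.integrableOn_bulk hmin hDM hDm hφ hφc hφU e, ?_⟩⟩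
      rw [setIntegral_of_tsupport_subset_compl (S := S')
        (hφU.trans (hU'S.trans inter_subset_left)), setIntegral_of_tsupport_subset_compl (S := S'')
        (hφU.trans (hU'S.trans inter_subset_right)), sub_zero]
      -- The exceptional level is arbitrary, since all of `M` in this neighbourhood belongs to `D`.
      refine hU'c.bulk_eq_zero_of_interior (t := 0) hmin hDM hDm hφ hφc hφU e fun x hx _ => ?_
      rw [hDO]
      exact ⟨hU'c.graphMap_mem hx, hx.2⟩

/-- Sum the localized identities over a partition of unity. The functions add up to `1` on the
cycles, giving the flow functionals, and to the constant `1` near each point of `D`, so the bulk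
integrands cancel pointwise. -/
theorem flowFunctional_eq_of_bordant (hM : IsEmbeddedHypersurface M) (hmin : IsMinimal M)
    (hS' : IsSectionPart M t' S') (hS'' : IsSectionPart M t'' S'')
    (hb : OrientedBordant M S' S'') (e : Space k) :
    flowFunctional M S' e = flowFunctional M S'' e := by
  obtain ⟨D, ⟨O, hO, hDO⟩, hDc, hbd, hb', hb'', hbb⟩ := hb
  have hDM : D ⊆ M := hDO ▸ inter_subset_left
  have hDm : MeasurableSet D := by
    -- Measurability of `D` comes from the compact set `M ∩ closure D`; none is assumed of `M`.
    have : D = (M ∩ closure D) ∩ O := by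
      refine Subset.antisymm (fun q hq => ⟨⟨hDM hq, subset_closure hq⟩, ?_⟩) fun q hq => ?_
      · rw [hDO] at hq; exact hq.2
      · rw [hDO]; exact ⟨hq.1.1, hq.2⟩
    rw [this]
    exact hDc.measurableSet.inter hO.measurableSet
  -- The cycles are added explicitly: where they overlap and `D` lies on neither side, they need not
  -- belong to `closure D`.
  set K := (M ∩ closure D) ∪ (S' ∪ S'') with hK
  have hKc : IsCompact K := hDc.union (hS'.isCompact.union hS''.isCompact)
  choose U₀ hU₀o hpU₀ hU₀ using fun (p : Space k) (hp : p ∈ K) =>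
    exists_nhds_flux_eq hM hmin hS' hS'' hDm hDM ⟨O, hO, hDO⟩ hbd hb' hb'' hbb hp
  choose U₁ hU₁o hpU₁ hU₁ using hS'.exists_nhds_integrableOn hM
  choose U₂ hU₂o hpU₂ hU₂ using hS''.exists_nhds_integrableOn hM
  classical
  set U : Space k → Set (Space k) := fun p => if hp : p ∈ K then (U₀ p hp ∩ U₁ p) ∩ U₂ p else ∅
  have hUeq : ∀ p (hp : p ∈ K), U p = (U₀ p hp ∩ U₁ p) ∩ U₂ p := fun p hp => dif_pos hp
  obtain ⟨s, φ, hsK, hφ, hφc, hφU, hsum⟩ := exists_partition_of_unity hKc (U := U)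
    (fun p hp => by
      rw [hUeq p hp]; exact ((hU₀o p hp).inter (hU₁o p)).inter (hU₂o p))
    (fun p hp => by rw [hUeq p hp]; exact ⟨⟨hpU₀ p hp, hpU₁ p⟩, hpU₂ p⟩)
  have hsub : ∀ i : s, tsupport (φ i) ⊆ (U₀ i (hsK i) ∩ U₁ i) ∩ U₂ i := fun i =>
    (hφU i).trans (hUeq i (hsK i)).subset
  have h0 := fun i : s => hU₀ i (hsK i) (φ i) (hφ i) (hφc i)
    ((hsub i).trans (inter_subset_left.trans inter_subset_left)) e
  have h1 := fun i : s => hU₁ i (φ i) (hφ i) (hφc i)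
    ((hsub i).trans (inter_subset_left.trans inter_subset_right)) e
  have h2 := fun i : s => hU₂ i (φ i) (hφ i) (hφc i) ((hsub i).trans inter_subset_right) e
  have hflow : ∀ S ⊆ K, MeasurableSet S →
      (∀ i, IntegrableOn (fun q => φ i q * ⟪e, conormal M q⟫_ℝ) S μHE[k]) →
      ∑ i, ∫ q in S, φ i q * ⟪e, conormal M q⟫_ℝ ∂μHE[k] = flowFunctional M S e := by
    intro S hSK hSm hint
    rw [← integral_finsetSum _ fun i _ => hint i, flowFunctional]
    refine setIntegral_congr_fun hSm fun q hq => ?_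
    change ∑ i, φ i q * ⟪e, conormal M q⟫_ℝ = _
    rw [← Finset.sum_mul, (hsum q (hSK hq)).self_of_nhds, one_mul]
  have hbulk : ∑ i, ∫ q in D, tangentialDeriv M (φ i) e q ∂μHE[k + 1] = 0 := by
    rw [← integral_finsetSum _ fun i _ => (h0 i).1]
    refine setIntegral_eq_zero_of_forall_eq_zero fun q hq => ?_
    have hqK : q ∈ K := Or.inl ⟨hDM hq, subset_closure hq⟩
    have hd : ∀ i, DifferentiableAt ℝ (φ i) q := fun i => (hφ i).differentiable (by simp) q
    have hz : ∑ i, fderiv ℝ (φ i) q = 0 := by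
      rw [← fderiv_fun_sum fun i _ => hd i]
      have : (fun y => ∑ i, φ i y) =ᶠ[𝓝 q] fun _ => (1 : ℝ) := hsum q hqK
      rw [this.fderiv_eq, fderiv_fun_const]
      rfl
    have := congrArg (fun L : Space k →L[ℝ] ℝ => L ((tangentSpace M q).starProjection e)) hz
    simpa [tangentialDeriv, sum_apply] using this
  rw [Finset.sum_congr rfl fun i _ => (h0 i).2, Finset.sum_sub_distrib,
    hflow S'' (subset_union_right.trans subset_union_right) hS''.isCompact.measurableSet h2,
    hflow S' (subset_union_left.trans subset_union_right) hS'.isCompact.measurableSet h1] at hbulk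
  linarith

theorem flowVector_eq_of_bordant (hM : IsEmbeddedHypersurface M) (hmin : IsMinimal M)
    (hS' : IsSectionPart M t' S') (hS'' : IsSectionPart M t'' S'')
    (hb : OrientedBordant M S' S'') : flowVector M S' = flowVector M S'' := by
  ext i
  exact flowFunctional_eq_of_bordant hM hmin hS' hS'' hb _

/-- Take the open slab of `M` between the two levels. Its closure lies in the compact portion of the
tube, and near either level the inequality at the other one holds automatically. -/
theorem orientedBordant_crossSection {T : Set ℝ} (hT : IsTube M T) {t₁ t₂ : ℝ} (h₁ : t₁ ∈ T)
    (h₂ : t₂ ∈ T) (hlt : t₁ < t₂) :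
    OrientedBordant M (crossSection M t₁) (crossSection M t₂) := by
  set D := M ∩ {q | t₁ < height q ∧ height q < t₂} with hD
  have hP := hT.isCompact_portion t₁ h₁ t₂ h₂
  have hcl : closure D ⊆ {p ∈ M | t₁ ≤ height p ∧ height p ≤ t₂} :=
    closure_minimal (fun q hq => ⟨hq.1, hq.2.1.le, hq.2.2.le⟩) hP.isClosed
  refine ⟨D, ⟨_, ?_, rfl⟩, ?_, ?_, ?_, ?_, ?_⟩
  · exact (isOpen_lt continuous_const continuous_height).inter
      (isOpen_lt continuous_height continuous_const)
  · rw [inter_eq_right.2 (hcl.trans fun q hq => hq.1)]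
    exact hP.of_isClosed_subset isClosed_closure hcl
  · rintro q ⟨⟨hqM, hqD⟩, hnD⟩
    obtain ⟨-, hq1, hq2⟩ := hcl hqD
    rcases hq1.eq_or_lt with h | h
    · exact Or.inl ⟨hqM, h.symm⟩
    rcases hq2.eq_or_lt with h' | h'
    · exact Or.inr ⟨hqM, h'⟩
    · exact absurd ⟨hqM, h, h'⟩ hnD
  · rintro p ⟨⟨hpM, hpt⟩, -⟩
    have h : ∀ᶠ q in 𝓝 p, height q < t₂ :=
      continuous_height.continuousAt.eventually_lt_const (by rwa [hpt])
    filter_upwards [nhdsWithin_le_nhds h, self_mem_nhdsWithin] with q hq hqM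
    rw [hpt]
    exact ⟨fun h => h.2.1, fun h => ⟨hqM, h, hq⟩⟩
  · rintro p ⟨⟨hpM, hpt⟩, -⟩
    have h : ∀ᶠ q in 𝓝 p, t₁ < height q :=
      (continuous_height.tendsto p).eventually_const_lt (by rwa [hpt])
    filter_upwards [nhdsWithin_le_nhds h, self_mem_nhdsWithin] with q hq hqM
    rw [hpt]
    exact ⟨fun h => h.2.2, fun h => ⟨hqM, hq, h⟩⟩
  · rintro p ⟨⟨-, hp⟩, ⟨-, hp'⟩⟩
    exact absurd (hp.symm.trans hp') hlt.ne

end Bordism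

end MinimalTube

/-! ### The theorem on flow vectors. -/

open MinimalTube
theorem proposition1 (k : ℕ) (hk : 1 ≤ k) (M : Set (Space k)) (T : Set ℝ)
    (hM : IsEmbeddedHypersurface M) (hT : IsTube M T) :
    -- the flow vector is well defined: the integrals converge and `F_Σ(e) = ⟨e, J(Σ)⟩`
    (∀ S : Set (Space k), IsCycle M T S →
      IntegrableOn (conormal M) S (Measure.euclideanHausdorffMeasure k) ∧
      ∀ e : Space k, flowFunctional M S e = ⟪e, flowVector M S⟫_ℝ) ∧
    -- additivity over the components of a cycle
    (∀ t ∈ T, IsRegularValue M t → ∀ (m : ℕ) (C : Fin m → Set (Space k)),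
      Function.Injective C → (∀ i, IsComponent M t (C i)) →
      flowVector M (⋃ i, C i) = ∑ i, flowVector M (C i)) ∧
    (IsMinimal M →
      -- invariance under oriented bordism
      (∀ S' S'' : Set (Space k), IsCycle M T S' → IsCycle M T S'' →
        OrientedBordant M S' S'' → flowVector M S' = flowVector M S'') ∧
      -- `J(M) = J(Σ_t)` makes sense and does not depend on `t`
      (∀ t₁ ∈ T, ∀ t₂ ∈ T, IsRegularValue M t₁ → IsRegularValue M t₂ →
        IsCycle M T (crossSection M t₁) ∧ IsCycle M T (crossSection M t₂) ∧
        flowVector M (crossSection M t₁) = flowVector M (crossSection M t₂))) := by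
  have hint : ∀ S, IsCycle M T S → IntegrableOn (conormal M) S μHE[k] := fun S hS => by
    obtain ⟨t, -, hp⟩ := hS.exists_isSectionPart hM hT
    exact hp.integrableOn_conormal hM
  have hbord : IsMinimal M → ∀ S' S'' : Set (Space k), IsCycle M T S' → IsCycle M T S'' →
      OrientedBordant M S' S'' → flowVector M S' = flowVector M S'' := by
    intro hmin S' S'' hS' hS'' hb
    obtain ⟨t', -, hp'⟩ := hS'.exists_isSectionPart hM hT
    obtain ⟨t'', -, hp''⟩ := hS''.exists_isSectionPart hM hT
    exact flowVector_eq_of_bordant hM hmin hp' hp'' hb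
  refine ⟨fun S hS => ⟨hint S hS, fun e => ?_⟩, fun t ht hreg m C hinj hC => ?_,
    fun hmin => ⟨hbord hmin, fun t₁ h₁ t₂ h₂ hr₁ hr₂ => ?_⟩⟩
  · rw [flowVector_eq_setIntegral (hint S hS), flowFunctional_eq_inner (hint S hS)]
  · have hp := fun i => (hC i).isSectionPart hM hreg (hT.isCompact_crossSection t ht)
    have hi := fun i => (hp i).integrableOn_conormal hM
    rw [flowVector_eq_setIntegral (hint _ ⟨t, ht, hreg, m, C, hC, rfl⟩),
      Finset.sum_congr rfl fun i _ => flowVector_eq_setIntegral (hi i)]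
    exact integral_iUnion_fintype (fun i => (hp i).isCompact.measurableSet)
      (fun i j hij => (hC i).disjoint (hC j) (hinj.ne hij)) hi
  · have hc₁ := isCycle_crossSection hM hT h₁ hr₁
    have hc₂ := isCycle_crossSection hM hT h₂ hr₂
    refine ⟨hc₁, hc₂, ?_⟩
    -- The slab is oriented from the lower section to the upper one, so the reversed order uses the
    -- bordism in the opposite direction.
    rcases lt_trichotomy t₁ t₂ with h | rfl | h
    · exact hbord hmin _ _ hc₁ hc₂ (orientedBordant_crossSection hT h₁ h₂ h)
    · rfl
    · exact (hbord hmin _ _ hc₂ hc₁ (orientedBordant_crossSection hT h₂ h₁ h)).symm
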